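/- **Definitions.** Write $\mathbf T=\mathbf R/\mathbf Z$, let $\|x\|$ be the distance from $x$ to the nearest integer, and let $e(x)=e^{2\pi i x}$. For an integer $d\ge 1$, $\theta\in\mathbf T^d$ and real $\varepsilon,N>0$ the *Bohr set* of dimension $d$ is $$\Lambda(\theta,\varepsilon,N)=\{n\in\mathbf Z:\ |n|\le N,\ \|n\theta_j\|<\varepsilon\ (1\le j\le d)\}$$ (a Bohr set is always given together with $\theta,\varepsilon,N$). For $0<\kappa<1$ it is *$\kappa$-regular* if $1-\kappa<|\Lambda(\theta,\varepsilon',N')|/|\Lambda(\theta,\varepsilon,N)|<1+\kappa$ for all real $\varepsilon',N'$ with $|\varepsilon-\varepsilon'|<\frac{\kappa}{100d}\varepsilon$ and $|N-N'|<\frac{\kappa}{100d}N$, and *regular* if it is $\kappa$-regular for every $\kappa\in(0,1)$. A regular Bohr set $\Lambda(\theta',\varepsilon',N')$ is an *$\varepsilon$ attendant* of $\Lambda(\theta,\varepsilon_0,N_0)$, $\theta\in\mathbf T^d$, if $\theta'=(\theta_1,\dots,\theta_d,\theta_{d+1},\dots,\theta_{d+k})$ for some $k\ge0$, $\varepsilon\varepsilon_0/2\le\varepsilon'\le\varepsilon\varepsilon_0$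 and $\varepsilon N_0/2\le N'\le\varepsilon N_0$. Write $\delta_P(Q)=|P\cap Q|/|P|$, identify sets with their characteristic functions, and put $\widehat f(x)=\sum_{s\in\mathbf Z} f(s)e(-sx)$, $x\in\mathbf T$. Let $\Lambda'$ be an $\varepsilon$ attendant of $\Lambda$, let $Q\subseteq\Lambda$ and $\delta_0=|Q|/|\Lambda|$. The set $Q$ is an *$(\alpha,\varepsilon)$-uniform subset of $\Lambda$ with respect to $\Lambda'$* if $$\big|\{m\in\Lambda:\ \|(Q\cap(\Lambda'+m)-\delta_0(\Lambda'+m))^{\wedge}\|_\infty\ge\alpha|\Lambda'|\}\big|\le\alpha|\Lambda|,$$ $$\frac1{|\Lambda|}\sum_{m\in\Lambda}|\delta_{\Lambda'+m}(Q)-\delta_0|^2\le\alpha^2,\qquad \|(Q-\delta_0\Lambda)^{\wedge}\|_\infty\le\alpha|\Lambda| .$$ **Proposition 5.9.** Let $\Lambda=\Lambda(\theta,\varepsilon_0,N)$ be a Bohr set, $\theta\in\mathbf T^d$, $0<\varepsilon_0\le 1$, and let $s_1,s_2\in\mathbf Z$. Let $\varepsilon,\sigma,\tau,\delta\in(0,1)$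 be real numbers and let $E_1,E_2\subset\mathbf Z$ be finite sets, $|E_i|=\beta_i|\Lambda|$ $(i=1,2)$. Suppose that $\mathbf E=E_1\times E_2\subseteq(\Lambda+s_1)\times(\Lambda+s_2)$, $A\subseteq\mathbf E$, $\delta_{\mathbf E}(A)=\delta+\tau$, that $\varepsilon\le\kappa/(100d)$ where $\kappa=2^{-100}(\tau\beta_1\beta_2)^5\sigma^3$, that $\Lambda$ is $\kappa$-regular (in particular this holds if $\Lambda$ is regular), that $$N\ \ge\ (2^{-100}\varepsilon_0\varepsilon)^{-2^{100}((\tau\beta_1\beta_2)^{-5}\sigma^{-3}+d)^2},$$ and that $\sigma\le2^{-100}\tau\beta_1\beta_2$. Then there exist a regular Bohr set $\Lambda'=\Lambda(\theta',\varepsilon',N')$, $\theta'\in\mathbf T^D$, with $$D\le2^{30}(\tau\beta_1\beta_2)^{-5}\sigma^{-3}+d,\qquad \varepsilon'\ge(2^{-10}\varepsilon)^D\varepsilon_0,\qquad N'\ge(2^{-10}\varepsilon)^DN,$$ and integers $t_1,t_2$ such that, with $E_i'=(E_i-t_i)\cap\Lambda'$ and $\mathbf E'=E_1'\times E_2'$: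 1. $|\mathbf E'|\ge\beta_1\beta_2\tau|\Lambda'|^2/16$; 2. there is an $\varepsilon$ attendant $\Lambda''$ of $\Lambda'$ such that both $E_1'$ and $E_2'$ are $(\sigma,\varepsilon)$-uniform subsets of $\Lambda'$ with respect to $\Lambda''$; 3. $\delta_{\mathbf E'}(A-(t_1,t_2))\ge\delta+\tau/16$. -/

import Mathlib

/-- The data `(θ, ε, N)` of a Bohr set: a generative vector `θ ∈ 𝕋^d` (with `d ≥ 1`),
a radius `ε > 0` and a length `N > 0`.  The length may be any positive real, as is needed
for rescaling a Bohr set by a small real factor. -/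
structure BohrDatum where
  dim : ℕ
  freq : Fin dim → UnitAddCircle
  radius : ℝ
  length : ℝ
  dim_pos : 0 < dim
  radius_pos : 0 < radius
  length_pos : 0 < length

open Classical in
/-- The set `{n ∈ ℤ : |n| ≤ N, ‖n θ_j‖ < ε for all j}`.  The norm of `UnitAddCircle = ℝ/ℤ` is
the distance to the nearest integer.  See `mem_bohrSet`. -/
noncomputable def bohrSet {d : ℕ} (θ : Fin d → UnitAddCircle) (ε N : ℝ) : Finset ℤ :=
  (Finset.Icc (-⌊N⌋) ⌊N⌋).filter (fun n : ℤ => ∀ j, ‖n • θ j‖ < ε)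

theorem mem_bohrSet {d : ℕ} (θ : Fin d → UnitAddCircle) (ε N : ℝ) (n : ℤ) :
    n ∈ bohrSet θ ε N ↔ |(n : ℝ)| ≤ N ∧ ∀ j, ‖n • θ j‖ < ε := by
  classical
  have h : (-⌊N⌋ ≤ n ∧ n ≤ ⌊N⌋) ↔ |(n : ℝ)| ≤ N := by
    rw [← abs_le, Int.le_floor, Int.cast_abs]
  simp only [bohrSet, Finset.mem_filter, Finset.mem_Icc, h]

namespace BohrDatum

/-- The Bohr set itself. -/
noncomputable def carrier (Λ : BohrDatum) : Finset ℤ :=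
  bohrSet Λ.freq Λ.radius Λ.length

/-- Regularity at the level `κ`. -/
def IsRegularAt (κ : ℝ) (Λ : BohrDatum) : Prop :=
  ∀ ε' N' : ℝ,
    |Λ.radius - ε'| < κ / (100 * (Λ.dim : ℝ)) * Λ.radius →
    |Λ.length - N'| < κ / (100 * (Λ.dim : ℝ)) * Λ.length →
      1 - κ < ((bohrSet Λ.freq ε' N').card : ℝ) / (Λ.carrier.card : ℝ) ∧
      ((bohrSet Λ.freq ε' N').card : ℝ) / (Λ.carrier.card : ℝ) < 1 + κ

/-- A regular Bohr set: regular at every level `0 < κ < 1`. -/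
def IsRegular (Λ : BohrDatum) : Prop :=
  ∀ κ : ℝ, 0 < κ → κ < 1 → Λ.IsRegularAt κ

/-- `Λ'` is an `ε` attendant of `Λ`: a regular Bohr set whose generative vector extends that of
`Λ` by some number `k ≥ 0` of further frequencies. -/
def IsAttendant (ε : ℝ) (Λ Λ' : BohrDatum) : Prop :=
  Λ'.IsRegular ∧
  (∃ h : Λ.dim ≤ Λ'.dim, ∀ j : Fin Λ.dim, Λ'.freq (Fin.castLE h j) = Λ.freq j) ∧
  (ε * Λ.radius / 2 ≤ Λ'.radius ∧ Λ'.radius ≤ ε * Λ.radius) ∧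
  (ε * Λ.length / 2 ≤ Λ'.length ∧ Λ'.length ≤ ε * Λ.length)

end BohrDatum

/-- The translate `E + t` of a finite set of integers. -/
def shiftSet (E : Finset ℤ) (t : ℤ) : Finset ℤ :=
  E.image (fun x => x + t)

/-- The translate `A + (t₁, t₂)` of a finite subset of `ℤ²`. -/
def shiftPairs (A : Finset (ℤ × ℤ)) (t₁ t₂ : ℤ) : Finset (ℤ × ℤ) :=
  A.image (fun p => (p.1 + t₁, p.2 + t₂))

/-- The density `δ_P(Q) = |Q ∩ P| / |P|` of `Q` in `P`. -/
noncomputable def relDensity {α : Type*} [DecidableEq α] (P Q : Finset α) : ℝ :=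
  ((Q ∩ P).card : ℝ) / (P.card : ℝ)

/-- The characteristic function of a finite set of integers. -/
noncomputable def charFn (E : Finset ℤ) (s : ℤ) : ℂ :=
  if s ∈ E then 1 else 0

/-- The Fourier transform `∑ₛ f(s) e(-s x)`, `x ∈ ℝ/ℤ`; it is only used for finitely supported
functions. -/
noncomputable def fourierTransform (f : ℤ → ℂ) (x : UnitAddCircle) : ℂ :=
  ∑' s : ℤ, f s * fourier (-s) x

/-- `‖f̂‖_∞`, for finitely supported `f`. -/
noncomputable def fourierSup (f : ℤ → ℂ) : ℝ :=
  ⨆ x : UnitAddCircle, ‖fourierTransform f x‖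

open Classical in
/-- The set of `m ∈ Λ` such that the Fourier transform of `Q ∩ (Λ' + m) - δ (Λ' + m)` has
supremum norm at least `α |Λ'|`. -/
noncomputable def badShifts (α δ : ℝ) (Λ Λ' Q : Finset ℤ) : Finset ℤ :=
  Λ.filter (fun m =>
    α * (Λ'.card : ℝ) ≤ fourierSup (fun s =>
      charFn (Q ∩ shiftSet Λ' m) s - (δ : ℂ) * charFn (shiftSet Λ' m) s))

/-- `Q` is an `(α, ε)`-uniform subset of the Bohr set `Λ`, with respect to the `ε` attendant
`Λ'` of `Λ`. -/
structure IsUniformSubset (α ε : ℝ) (Λ Λ' : BohrDatum) (Q : Finset ℤ) : Prop where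
  attendant : BohrDatum.IsAttendant ε Λ Λ'
  subset : Q ⊆ Λ.carrier
  local_fourier :
    ((badShifts α (relDensity Λ.carrier Q) Λ.carrier Λ'.carrier Q).card : ℝ)
      ≤ α * (Λ.carrier.card : ℝ)
  local_density :
    1 / (Λ.carrier.card : ℝ) * ∑ m ∈ Λ.carrier,
      |relDensity (shiftSet Λ'.carrier m) Q - relDensity Λ.carrier Q| ^ 2 ≤ α ^ 2
  global_fourier :
    fourierSup (fun s => charFn (Q ∩ Λ.carrier) s
      - (relDensity Λ.carrier Q : ℂ) * charFn Λ.carrier s) ≤ α * (Λ.carrier.card : ℝ)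

/-!
The proof is an energy increment argument over boxes `(Λ' + t₁) × (Λ' + t₂)`, with `Λ'` a regular
Bohr set. To such a box belong the mean of the weight `w = 1_A - (δ + τ/16) 1_{E₁ × E₂}`, which is
positive only if `A` has relative density above `δ + τ/16`, and the energy, the sum of the squares
of the densities of `E₁` on `Λ' + t₁` and of `E₂` on `Λ' + t₂`. A mean larger than `τ β₁ β₂ / 16`
already gives the first and the third property of the conclusion
(`mass_and_density_of_lt_boxMean`), so that such a box can only fail because `E₁` or `E₂` is not
uniform.

In that case the box is refined. Near each point of `Λ'` there is a smaller Bohr set, with one new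
frequency, and non-uniformity makes the densities of the set on these smaller Bohr sets deviate from
their mean, so that on average the energy grows by `σ³/16` while the mean of `w` is almost unchanged
(`exists_refinement_of_not_uniform`). The new frequency depends on the point, as local Fourier
uniformity fails with a different character at each bad shift; the smaller boxes are therefore
followed one by one, through the combination of mean and energy in `mul_boxMean_le`. Since
the energy is at most `2`, the mean of `w` cannot be as large as `15/16 · τ β₁ β₂`, its value on
the given box (`boxMean_balancedWeight_of_subset`), if all boxes with large mean fail.

All errors come from boundaries of Bohr sets, through the notion of `AlmostInvariant`. The
number `ε` is small in terms of the initial dimension `d` only, and shifts on the scale `ε` may move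
a Bohr set of dimension about `σ⁻³` by more than the increment allows. This is where the freedom in
the definition of an attendant is used: its additional frequencies can be multiples of the old ones,
which makes all its elements small on the scale `ε²` (`exists_isFineAttendant`), and that is enough
for all dimensions that occur.

Regular Bohr sets on a given scale are provided by a Vitali covering argument applied to the
logarithm of the size of a Bohr set as a function of the scale (`exists_regular_scale`).
-/

open Finset
open scoped BigOperators

/-! ### Sizes of Bohr sets -/

theorem bohrSet_mono {d : ℕ} (θ : Fin d → UnitAddCircle) {ε₁ ε₂ N₁ N₂ : ℝ} (hε : ε₁ ≤ ε₂)
    (hN : N₁ ≤ N₂) : bohrSet θ ε₁ N₁ ⊆ bohrSet θ ε₂ N₂ := by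
  intro n hn
  rw [mem_bohrSet] at hn ⊢
  exact ⟨hn.1.trans hN, fun j => (hn.2 j).trans_le hε⟩

theorem zero_mem_bohrSet {d : ℕ} (θ : Fin d → UnitAddCircle) {ε N : ℝ} (hε : 0 < ε)
    (hN : 0 ≤ N) : (0 : ℤ) ∈ bohrSet θ ε N := by
  rw [mem_bohrSet]
  simpa using ⟨hN, fun _ => hε⟩

theorem BohrDatum.carrier_nonempty (Λ : BohrDatum) : Λ.carrier.Nonempty :=
  ⟨0, zero_mem_bohrSet _ Λ.radius_pos Λ.length_pos.le⟩

theorem UnitAddCircle.exists_real_rep (x : UnitAddCircle) :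
    ∃ y : ℝ, (y : UnitAddCircle) = x ∧ |y| = ‖x‖ := by
  induction x using QuotientAddGroup.induction_on with
  | H z =>
    refine ⟨z - round z, ?_, (UnitAddCircle.norm_eq (x := z)).symm⟩
    have : ((round z : ℝ) : UnitAddCircle) = 0 := by
      simp
    rw [AddCircle.coe_sub, this, sub_zero]

/-- Points of the large Bohr set whose coordinates lie in a common cell of side `ε` (and `N` in
the length direction) differ by points of the small one, and five cells suffice in each
direction. -/
theorem card_bohrSet_le {d : ℕ} (θ : Fin d → UnitAddCircle) {ε₁ ε₂ N₁ N₂ : ℝ} (hε₁ : 0 < ε₁)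
    (hN₁ : 0 < N₁) (hε : ε₂ ≤ 12 / 5 * ε₁) (hN : N₂ ≤ 12 / 5 * N₁) :
    (bohrSet θ ε₂ N₂).card ≤ 5 ^ (d + 1) * (bohrSet θ ε₁ N₁).card := by
  classical
  choose y hy hy' using fun (n : ℤ) (j : Fin d) => UnitAddCircle.exists_real_rep (n • θ j)
  let f : ℤ → ℤ × (Fin d → ℤ) := fun n =>
    (⌊(n : ℝ) / N₁ + 5 / 2⌋, fun j => ⌊y n j / ε₁ + 5 / 2⌋)
  have cell : ∀ {a b : ℝ}, 0 < b → |a| ≤ 12 / 5 * b → ⌊a / b + 5 / 2⌋ ∈ Icc (0 : ℤ) 4 := by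
    intro a b hb hab
    have h := abs_le.1 hab
    have h1 : -(12 / 5) ≤ a / b := by rw [le_div_iff₀ hb]; linarith
    have h2 : a / b ≤ 12 / 5 := by rw [div_le_iff₀ hb]; linarith
    rw [Finset.mem_Icc]
    refine ⟨Int.floor_nonneg.2 (by linarith), ?_⟩
    have : ⌊a / b + 5 / 2⌋ < 5 := Int.floor_lt.2 (by push_cast; linarith)
    omega
  have same : ∀ {a a' b : ℝ}, 0 < b → ⌊a / b + 5 / 2⌋ = ⌊a' / b + 5 / 2⌋ → |a - a'| < b := by
    intro a a' b hb h
    have h1 := Int.abs_sub_lt_one_of_floor_eq_floor h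
    have h2 : a / b + 5 / 2 - (a' / b + 5 / 2) = (a - a') / b := by ring
    rwa [h2, abs_div, abs_of_pos hb, div_lt_one hb] at h1
  have hmaps : ∀ n ∈ bohrSet θ ε₂ N₂,
      f n ∈ (Icc (0 : ℤ) 4) ×ˢ Fintype.piFinset (fun _ : Fin d => Icc (0 : ℤ) 4) := by
    intro n hn
    rw [mem_bohrSet] at hn
    rw [Finset.mem_product, Fintype.mem_piFinset]
    refine ⟨cell hN₁ (hn.1.trans hN), fun j => cell hε₁ ?_⟩
    rw [hy']
    exact (hn.2 j).le.trans hε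
  have hfib : ∀ b ∈ (Icc (0 : ℤ) 4) ×ˢ Fintype.piFinset (fun _ : Fin d => Icc (0 : ℤ) 4),
      ((bohrSet θ ε₂ N₂).filter (fun n => f n = b)).card ≤ (bohrSet θ ε₁ N₁).card := by
    intro b _
    rcases ((bohrSet θ ε₂ N₂).filter (fun n => f n = b)).eq_empty_or_nonempty with h | ⟨m, hm⟩
    · simp [h]
    · refine Finset.card_le_card_of_injOn (fun n => n - m) ?_ (fun a _ b _ h => by simpa using h)
      intro n hn
      have hn := (Finset.mem_filter.1 hn).2
      have hm := (Finset.mem_filter.1 hm).2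
      have hnm : f n = f m := hn.trans hm.symm
      simp only [f, Prod.mk.injEq] at hnm
      show n - m ∈ bohrSet θ ε₁ N₁
      rw [mem_bohrSet]
      refine ⟨?_, fun j => ?_⟩
      · push_cast
        exact (same hN₁ hnm.1).le
      · have h := same hε₁ (congrFun hnm.2 j)
        rw [sub_smul, ← hy n j, ← hy m j, ← AddCircle.coe_sub]
        exact (QuotientAddGroup.norm_mk_le_norm).trans_lt h
  have := Finset.card_le_mul_card_image_of_maps_to hmaps _ hfib
  refine this.trans (le_of_eq ?_)
  rw [Finset.card_product, Fintype.card_piFinset]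
  simp [pow_succ]
  ring

/-! ### Existence of regular Bohr sets -/

/-- A monotone function increases over disjoint intervals by at most its total increase. -/
theorem sum_increments_le {ι : Type*} (G : ℝ → ℝ) (l r : ι → ℝ) (v : Finset ι) (A B : ℝ)
    (hG : MonotoneOn G (Set.Icc A B))
    (hlr : ∀ i ∈ v, l i ≤ r i) (hA : ∀ i ∈ v, A ≤ l i) (hB : ∀ i ∈ v, r i ≤ B) (hAB : A ≤ B)
    (hd : (v : Set ι).PairwiseDisjoint (fun i => Set.Icc (l i) (r i))) :
    ∑ i ∈ v, (G (r i) - G (l i)) ≤ G B - G A := by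
  classical
  induction hn : v.card using Nat.strong_induction_on generalizing v B with
  | _ k ih =>
    rcases v.eq_empty_or_nonempty with rfl | hne
    · simpa using hG ⟨le_rfl, hAB⟩ ⟨hAB, le_rfl⟩ hAB
    obtain ⟨i, hi, hmax⟩ := v.exists_max_image l hne
    rw [← Finset.add_sum_erase v _ hi]
    have h1 := ih _ (by rw [← hn]; exact Finset.card_erase_lt_of_mem hi) (v.erase i) (l i)
      (hG.mono (Set.Icc_subset_Icc_right ((hlr i hi).trans (hB i hi))))
      (fun j hj => hlr j (Finset.mem_of_mem_erase hj))
      (fun j hj => hA j (Finset.mem_of_mem_erase hj)) ?_ (hA i hi)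
      (hd.subset (by exact_mod_cast Finset.erase_subset i v)) rfl
    · have := hG ⟨(hA i hi).trans (hlr i hi), hB i hi⟩ ⟨hAB, le_rfl⟩ (hB i hi)
      linarith
    · intro j hj
      have hj' := Finset.mem_of_mem_erase hj
      by_contra! hlt
      exact Set.disjoint_left.1 (hd (by exact_mod_cast hj') (by exact_mod_cast hi)
        (Finset.ne_of_mem_erase hj)) ⟨hmax j hj', hlt.le⟩ ⟨le_rfl, hlr i hi⟩

/-- Vitali's covering lemma, in the form: if every point of `[1/2, 1]` is the centre of a short
interval over which the monotone function `G` increases at an average rate of at least `L`, then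
the total increase of `G` is at least `L / 8`. -/
theorem le_total_increase (G a : ℝ → ℝ) (L : ℝ) (hL : 0 < L)
    (hG : MonotoneOn G (Set.Icc (49 / 100) (101 / 100)))
    (ha : ∀ c ∈ Set.Icc (1 / 2 : ℝ) 1, 0 < a c ∧ a c ≤ 1 / 100 ∧
      L * (2 * a c) ≤ G (c + a c) - G (c - a c)) :
    L / 8 ≤ G (101 / 100) - G (49 / 100) := by
  obtain ⟨u, hu, hdisj, hcov⟩ := Vitali.exists_disjoint_subfamily_covering_enlargement_closedBall
    (Set.Icc (1 / 2 : ℝ) 1) (fun c : ℝ => c) a (1 / 100) (fun c hc => (ha c hc).2.1) 4 (by norm_num)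
  have hcount : u.Countable := by
    refine hdisj.countable_of_nonempty_interior (fun c hc => ?_)
    rw [Real.closedBall_eq_Icc, interior_Icc]
    have := (ha c (hu hc)).1
    exact ⟨c, by constructor <;> linarith⟩
  set I := G (101 / 100) - G (49 / 100) with hI
  have hfin : ∀ v : Finset u, ∑ i ∈ v, ENNReal.ofReal (8 * a i) ≤ ENNReal.ofReal (4 * I / L) := by
    intro v
    rw [← ENNReal.ofReal_sum_of_nonneg (fun (i : u) _ => by have := (ha i (hu i.2)).1; positivity)]
    apply ENNReal.ofReal_le_ofReal
    have h1 : ∑ i ∈ v, (G ((i : ℝ) + a i) - G ((i : ℝ) - a i)) ≤ I := by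
      refine sum_increments_le G (fun i : u => (i : ℝ) - a i) (fun i : u => (i : ℝ) + a i) v
        (49 / 100) (101 / 100) hG ?_ ?_ ?_ (by norm_num) ?_
      · intro i _; have := (ha i (hu i.2)).1; linarith
      · intro i _; have := (ha i (hu i.2)).2.1; have := (hu i.2).1; linarith
      · intro i _; have := (ha i (hu i.2)).2.1; have := (hu i.2).2; linarith
      · intro i _ j _ hij
        have := hdisj i.2 j.2 (fun h => hij (Subtype.ext h))
        simpa only [Function.onFun, Real.closedBall_eq_Icc] using this
    have h2 : ∑ i ∈ v, L * (2 * a i) ≤ I :=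
      (Finset.sum_le_sum fun (i : u) _ => (ha i (hu i.2)).2.2).trans h1
    rw [le_div_iff₀ hL, Finset.sum_mul]
    have h3 : ∑ i ∈ v, 8 * a (i : ℝ) * L = 4 * ∑ i ∈ v, L * (2 * a (i : ℝ)) := by
      rw [Finset.mul_sum]; exact Finset.sum_congr rfl fun i _ => by ring
    rw [h3]; linarith
  have hvol : MeasureTheory.volume (Set.Icc (1 / 2 : ℝ) 1) ≤ ENNReal.ofReal (4 * I / L) := by
    have hsub : Set.Icc (1 / 2 : ℝ) 1 ⊆ ⋃ c ∈ u, Metric.closedBall c (4 * a c) := by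
      intro c hc
      obtain ⟨b, hb, hcb⟩ := hcov c hc
      exact Set.mem_biUnion hb (hcb (Metric.mem_closedBall_self (ha c hc).1.le))
    refine (MeasureTheory.measure_mono hsub).trans
      ((MeasureTheory.measure_biUnion_le _ hcount _).trans ?_)
    have : ∀ c : u, MeasureTheory.volume (Metric.closedBall (c : ℝ) (4 * a c))
        = ENNReal.ofReal (8 * a c) := fun c => by
      rw [Real.volume_closedBall]; congr 1; ring
    simp_rw [this]
    rw [ENNReal.tsum_eq_iSup_sum]
    exact iSup_le hfin
  rw [Real.volume_Icc, ENNReal.ofReal_le_ofReal_iff'] at hvol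
  rcases hvol with h | h
  · rw [le_div_iff₀ hL] at h
    linarith
  · norm_num at h

/-- Between half of a given scale and the scale itself there is a regular Bohr set.  At a scale that
is not regular, the logarithm of the size of the Bohr set increases at a rate of order `50 d log 2`,
while its total increase is at most `(d + 1) log 5`. -/
theorem exists_regular_scale {d : ℕ} (hd : 0 < d) (θ : Fin d → UnitAddCircle) {ε N : ℝ}
    (hε : 0 < ε) (hN : 0 < N) :
    ∃ Λ : BohrDatum, Λ.IsRegular ∧ (∃ h : Λ.dim = d, ∀ j, Λ.freq j = θ (Fin.cast h j)) ∧
      (∀ n, n ∈ Λ.carrier ↔ |(n : ℝ)| ≤ Λ.length ∧ ∀ j, ‖n • θ j‖ < Λ.radius) ∧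
      (ε / 2 ≤ Λ.radius ∧ Λ.radius ≤ ε) ∧ (N / 2 ≤ Λ.length ∧ Λ.length ≤ N) := by
  by_contra hcon
  have hd' : (1 : ℝ) ≤ d := by exact_mod_cast hd
  set F : ℝ → ℝ := fun c => ((bohrSet θ (c * ε) (c * N)).card : ℝ) with hF
  have hFpos : ∀ c, 0 < c → 0 < F c := fun c hc => by
    simp only [hF]
    exact_mod_cast Finset.card_pos.2 ⟨0, zero_mem_bohrSet θ (by positivity) (by positivity)⟩
  have hFmono : ∀ a b, a ≤ b → F a ≤ F b := fun a b hab => by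
    simp only [hF]
    exact_mod_cast Finset.card_le_card (bohrSet_mono θ (by gcongr) (by gcongr))
  have key : ∀ c : ℝ, ∃ a : ℝ, c ∈ Set.Icc (1 / 2 : ℝ) 1 → 0 < a ∧ a ≤ 1 / 100 ∧
      (50 * d * Real.log 2) * (2 * a) ≤ Real.log (F (c + a)) - Real.log (F (c - a)) := by
    intro c
    by_cases hc : c ∈ Set.Icc (1 / 2 : ℝ) 1
    swap
    · exact ⟨0, fun h => absurd h hc⟩
    have hc0 : 0 < c := by linarith [hc.1]
    let Λ : BohrDatum := ⟨d, θ, c * ε, c * N, hd, by positivity, by positivity⟩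
    have hnot : ¬ Λ.IsRegular := by
      intro hreg
      refine hcon ⟨Λ, hreg, ⟨rfl, fun _ => rfl⟩, fun n => mem_bohrSet _ _ _ _, ⟨?_, ?_⟩, ?_, ?_⟩
      · show ε / 2 ≤ c * ε; nlinarith [hc.1]
      · show c * ε ≤ ε; nlinarith [hc.2]
      · show N / 2 ≤ c * N; nlinarith [hc.1]
      · show c * N ≤ N; nlinarith [hc.2]
    simp only [BohrDatum.IsRegular, not_forall] at hnot
    obtain ⟨κ, hκ0, hκ1, hnot⟩ := hnot
    simp only [BohrDatum.IsRegularAt, not_forall] at hnot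
    obtain ⟨ε', N', h1, h2, hnot⟩ := hnot
    set h : ℝ := κ / (100 * (d : ℝ)) with hh
    have h1' : |c * ε - ε'| < h * (c * ε) := h1
    have h2' : |c * N - N'| < h * (c * N) := h2
    have hhpos : 0 < h := by positivity
    have hd100 : h * (100 * d) = κ := by rw [hh]; field_simp
    have hhle : h ≤ 1 / 100 := by
      have : h ≤ h * d := by nlinarith
      linarith
    have hcF : (Λ.carrier.card : ℝ) = F c := rfl
    set M : ℝ := ((bohrSet Λ.freq ε' N').card : ℝ) with hM
    rw [hcF] at hnot
    have hlow : F (c - c * h) ≤ M := by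
      simp only [hF, hM]
      have := (abs_lt.1 h1').2
      have := (abs_lt.1 h2').2
      exact_mod_cast Finset.card_le_card (bohrSet_mono θ (by nlinarith) (by nlinarith))
    have hup : M ≤ F (c + c * h) := by
      simp only [hF, hM]
      have := (abs_lt.1 h1').1
      have := (abs_lt.1 h2').1
      exact_mod_cast Finset.card_le_card (bohrSet_mono θ (by nlinarith) (by nlinarith))
    have hFc := hFpos c hc0
    have hch : 0 < c * h := by positivity
    have hchle : c * h ≤ h := by nlinarith [hc.2]
    have hFl := hFpos (c - c * h) (by nlinarith)
    have hFcl := hFmono (c - c * h) c (by linarith)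
    have hFcu := hFmono c (c + c * h) (by linarith)
    have hjump : (1 + κ) * F (c - c * h) ≤ F (c + c * h) := by
      rw [lt_div_iff₀ hFc, div_lt_iff₀ hFc, not_and_or, not_lt, not_lt] at hnot
      rcases hnot with h | h
      · nlinarith
      · nlinarith
    refine ⟨c * h, fun _ => ⟨hch, by linarith, ?_⟩⟩
    have hlog : Real.log (1 + κ) + Real.log (F (c - c * h)) ≤ Real.log (F (c + c * h)) := by
      rw [← Real.log_mul (by positivity) hFl.ne']
      exact Real.log_le_log (by positivity) hjump
    have hκlog : κ * Real.log 2 ≤ Real.log (1 + κ) := by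
      have := strictConcaveOn_log_Ioi.concaveOn.2 (Set.mem_Ioi.2 one_pos)
        (Set.mem_Ioi.2 two_pos) (by linarith : 0 ≤ 1 - κ) hκ0.le (by ring)
      simp only [smul_eq_mul, Real.log_one, mul_zero, zero_add, mul_one] at this
      calc κ * Real.log 2 ≤ Real.log (1 - κ + κ * 2) := this
        _ = Real.log (1 + κ) := by ring_nf
    have hlog2 := Real.log_pos (by norm_num : (1 : ℝ) < 2)
    have : (50 * d * Real.log 2) * (2 * (c * h)) ≤ κ * Real.log 2 := by
      rw [← hd100]
      have : c * h * (100 * d * Real.log 2) ≤ h * (100 * d * Real.log 2) :=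
        mul_le_mul_of_nonneg_right hchle (by positivity)
      linarith
    linarith
  choose a ha using key
  have hlog2 := Real.log_pos (by norm_num : (1 : ℝ) < 2)
  have htot := le_total_increase (fun c => Real.log (F c)) a (50 * d * Real.log 2) (by positivity)
    (fun x hx y _ hxy => Real.log_le_log (hFpos x (by linarith [hx.1])) (hFmono x y hxy)) ha
  have hsize : F (101 / 100) ≤ 5 ^ (d + 1) * F (49 / 100) := by
    simp only [hF]
    exact_mod_cast card_bohrSet_le θ (ε₁ := 49 / 100 * ε) (N₁ := 49 / 100 * N) (by positivity)
      (by positivity) (by linarith) (by linarith)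
  have hF49 := hFpos (49 / 100) (by norm_num)
  have hlogsize : Real.log (F (101 / 100)) ≤ (d + 1) * Real.log 5 + Real.log (F (49 / 100)) := by
    have h := Real.log_le_log (hFpos (101 / 100) (by norm_num)) hsize
    rw [Real.log_mul (by positivity) hF49.ne', Real.log_pow] at h
    exact_mod_cast h
  -- `5 ^ 3 < 2 ^ 7` and `2 * 7 / 3 < 50 / 8`
  have h5 : 3 * Real.log 5 < 7 * Real.log 2 := by
    have : Real.log (5 ^ 3) < Real.log (2 ^ 7) := Real.log_lt_log (by norm_num) (by norm_num)
    simpa [Real.log_pow] using this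
  have h5' : 0 < Real.log 5 := Real.log_pos (by norm_num)
  nlinarith

/-! ### Almost invariance under small shifts -/

/-- The average over `B` of every bounded function changes by at most `κ` when the function is
translated by `n`. -/
def AlmostInvariant (κ : ℝ) (B : Finset ℤ) (n : ℤ) : Prop :=
  ∀ w : ℤ → ℂ, (∀ m, ‖w m‖ ≤ 1) → ‖(𝔼 m ∈ B, w (m + n)) - 𝔼 m ∈ B, w m‖ ≤ κ

/-- A shift on the scale permitted by regularity moves at most a proportion `κ` of the Bohr set out
of it. -/
theorem almostInvariant_of_isRegularAt {κ h : ℝ} {Λ : BohrDatum} (hreg : Λ.IsRegularAt κ)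
    (hh : h < κ / (100 * (Λ.dim : ℝ))) {n : ℤ} (hn : |(n : ℝ)| ≤ h * Λ.length)
    (hθ : ∀ j, ‖n • Λ.freq j‖ ≤ h * Λ.radius) : AlmostInvariant (2 * κ) Λ.carrier n := by
  classical
  intro w hw
  have hh0 : 0 ≤ h := by
    by_contra! hneg
    have := (abs_nonneg (n : ℝ)).trans hn
    nlinarith [Λ.length_pos]
  set B := Λ.carrier with hB
  set B' := B.map (addRightEmbedding n) with hB'
  have hBpos : (0 : ℝ) < B.card := by exact_mod_cast Λ.carrier_nonempty.card_pos
  have hcard' : B'.card = B.card := Finset.card_map _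
  have hsum : ∑ m ∈ B, w (m + n) = ∑ m ∈ B', w m := by simp [hB']
  have hunion : B' ∪ B ⊆ bohrSet Λ.freq (Λ.radius + h * Λ.radius) (Λ.length + h * Λ.length) := by
    refine Finset.union_subset ?_ (bohrSet_mono _ ?_ ?_)
    · intro m hm
      obtain ⟨k, hk, rfl⟩ := Finset.mem_map.1 hm
      rw [hB, BohrDatum.carrier, mem_bohrSet] at hk
      simp only [addRightEmbedding_apply]
      rw [mem_bohrSet]
      refine ⟨?_, fun j => ?_⟩
      · push_cast
        exact (abs_add_le _ _).trans (add_le_add hk.1 hn)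
      · rw [add_smul]
        exact (norm_add_le _ _).trans_lt (add_lt_add_of_lt_of_le (hk.2 j) (hθ j))
    · nlinarith [Λ.radius_pos]
    · nlinarith [Λ.length_pos]
  have hr := hreg (Λ.radius + h * Λ.radius) (Λ.length + h * Λ.length)
    (by rw [sub_add_cancel_left, abs_neg, abs_of_nonneg (mul_nonneg hh0 Λ.radius_pos.le)]
        exact mul_lt_mul_of_pos_right hh Λ.radius_pos)
    (by rw [sub_add_cancel_left, abs_neg, abs_of_nonneg (mul_nonneg hh0 Λ.length_pos.le)]
        exact mul_lt_mul_of_pos_right hh Λ.length_pos)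
  have hr2 := hr.2
  rw [div_lt_iff₀ hBpos] at hr2
  have hle : ((B' ∪ B).card : ℝ) ≤ (1 + κ) * B.card :=
    le_trans (by exact_mod_cast Finset.card_le_card hunion) hr2.le
  have h1 : ((B' \ B).card : ℝ) ≤ κ * B.card := by
    have : (B' ∪ B).card = (B' \ B).card + B.card := by
      rw [← Finset.card_sdiff_add_card]
    rw [this] at hle; push_cast at hle; linarith
  have h2 : (B \ B').card = (B' \ B).card := by
    have e1 := Finset.card_sdiff_add_card_inter B B'
    have e2 := Finset.card_sdiff_add_card_inter B' B
    rw [Finset.inter_comm] at e2; omega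
  have hbound : ∀ s : Finset ℤ, ‖∑ m ∈ s, w m‖ ≤ s.card := fun s => by
    simpa using norm_sum_le_of_le s (fun m _ => hw m)
  have hdiff : ∑ m ∈ B', w m - ∑ m ∈ B, w m = ∑ m ∈ B' \ B, w m - ∑ m ∈ B \ B', w m := by
    rw [← Finset.sum_sdiff_sub_sum_sdiff]
  rw [Finset.expect_eq_sum_div_card, Finset.expect_eq_sum_div_card, hsum, ← sub_div, norm_div,
    hdiff, Complex.norm_natCast, div_le_iff₀ hBpos]
  calc _ ≤ _ := norm_sub_le _ _
    _ ≤ ((B' \ B).card : ℝ) + (B \ B').card := add_le_add (hbound _) (hbound _)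
    _ ≤ 2 * κ * B.card := by rw [h2]; linarith

/-! ### Attendants and refinements -/

theorem UnitAddCircle.norm_smul_eq (n : ℤ) (x : UnitAddCircle) (h : |(n : ℝ)| * ‖x‖ ≤ 1 / 2) :
    ‖n • x‖ = |(n : ℝ)| * ‖x‖ := by
  obtain ⟨y, rfl, hy⟩ := UnitAddCircle.exists_real_rep x
  rw [← hy, ← abs_mul] at h ⊢
  rw [← AddCircle.coe_zsmul, zsmul_eq_mul]
  exact (AddCircle.norm_coe_eq_abs_iff (1 : ℝ) one_ne_zero).2 (by simpa using h)

theorem UnitAddCircle.norm_smul_coe_le (n : ℤ) (a : ℝ) :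
    ‖n • (a : UnitAddCircle)‖ ≤ |(n : ℝ)| * |a| := by
  rw [← AddCircle.coe_zsmul, zsmul_eq_mul, ← abs_mul]
  exact QuotientAddGroup.norm_mk_le_norm

/-- `Λ'` is an `ε` attendant of `Λ` all of whose elements are small for `Λ` on the scale `4 ε²`
rather than `ε`, and elements which are small for `Λ` on the scale `ε⁴` are small for `Λ'` on the
scale `ε²`. -/
structure IsFineAttendant (ε : ℝ) (Λ Λ' : BohrDatum) : Prop where
  attendant : Λ.IsAttendant ε Λ'
  dim_eq : Λ'.dim = Λ.dim + Λ.dim + 1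
  small : ∀ n ∈ Λ'.carrier, |(n : ℝ)| ≤ 4 * ε ^ 2 * Λ.length ∧
    ∀ j, ‖n • Λ.freq j‖ ≤ 4 * ε ^ 2 * Λ.radius
  small_of_small : ∀ n : ℤ, |(n : ℝ)| ≤ ε ^ 4 * Λ.length →
    (∀ j, ‖n • Λ.freq j‖ ≤ ε ^ 4 * Λ.radius) →
      |(n : ℝ)| ≤ ε ^ 2 * Λ'.length ∧ ∀ j, ‖n • Λ'.freq j‖ ≤ ε ^ 2 * Λ'.radius

/-- The gain in scale comes from the additional frequencies `K θ_j`, with `K` close to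
`1 / (2 ε)`, and from a small real frequency which restricts the length. -/
theorem exists_isFineAttendant (Λ : BohrDatum) (hr : Λ.radius ≤ 1) {ε : ℝ} (hε : 0 < ε)
    (hε2 : ε ≤ 1 / 2) : ∃ Λ', IsFineAttendant ε Λ Λ' := by
  have hr0 := Λ.radius_pos
  have hN0 := Λ.length_pos
  set K : ℕ := ⌊1 / (2 * ε)⌋₊ with hK
  have hy1 : 1 ≤ 1 / (2 * ε) := by rw [le_div_iff₀ (by positivity)]; linarith
  have hKle : (K : ℝ) ≤ 1 / (2 * ε) := Nat.floor_le (by positivity)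
  have hKlt : 1 / (2 * ε) < K + 1 := Nat.lt_floor_add_one _
  have hK1 : (1 : ℝ) ≤ K := by exact_mod_cast (Nat.le_floor (by exact_mod_cast hy1) : 1 ≤ K)
  have hKε : (K : ℝ) * ε ≤ 1 / 2 := by
    rw [le_div_iff₀ (by positivity)] at hKle; linarith
  have hKε' : 1 / 4 ≤ (K : ℝ) * ε := by
    rw [div_lt_iff₀ (by positivity)] at hKlt; nlinarith
  have hKcast : |(((K : ℤ) : ℤ) : ℝ)| = K := by simp
  set α : ℝ := Λ.radius / (2 * ε * Λ.length) with hα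
  have hα0 : 0 < α := by positivity
  have hαN : α * Λ.length * (2 * ε) = Λ.radius := by rw [hα]; field_simp
  let θ : Fin (Λ.dim + Λ.dim + 1) → UnitAddCircle :=
    Fin.append (Fin.append Λ.freq (fun j => (K : ℤ) • Λ.freq j)) (fun _ => (α : UnitAddCircle))
  have hθ1 : ∀ j, θ (Fin.castAdd 1 (Fin.castAdd _ j)) = Λ.freq j := fun j => by
    simp only [θ, Fin.append_left]
  have hθ2 : ∀ j, θ (Fin.castAdd 1 (Fin.natAdd _ j)) = (K : ℤ) • Λ.freq j := fun j => by
    simp only [θ, Fin.append_left, Fin.append_right]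
  have hθ3 : ∀ j, θ (Fin.natAdd _ j) = (α : UnitAddCircle) := fun j => by
    simp only [θ, Fin.append_right]
  obtain ⟨Λ', hreg, ⟨hdim, hfreq⟩, hmem, hrad, hlen⟩ :=
    exists_regular_scale (d := Λ.dim + Λ.dim + 1) (by omega) θ (mul_pos hε hr0) (mul_pos hε hN0)
  refine ⟨Λ', ⟨hreg, ⟨by omega, fun j => ?_⟩, hrad, hlen⟩, hdim, ?_, ?_⟩
  · rw [hfreq, ← hθ1 j]; rfl
  · intro n hn
    rw [hmem] at hn
    have hεr : ε * Λ.radius ≤ ε := by nlinarith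
    refine ⟨?_, fun j => ?_⟩
    · have h3 := hn.2 (Fin.natAdd (Λ.dim + Λ.dim) 0)
      have hnN : |(n : ℝ)| ≤ ε * Λ.length := hn.1.trans hlen.2
      have hnα : |(n : ℝ)| * α ≤ Λ.radius / 2 := by
        have := mul_le_mul_of_nonneg_right hnN hα0.le
        linarith
      have hα1 : ‖(α : UnitAddCircle)‖ ≤ α := by
        simpa [abs_of_pos hα0] using UnitAddCircle.norm_smul_coe_le 1 α
      rw [hθ3, ← AddCircle.coe_zsmul, zsmul_eq_mul,
        (AddCircle.norm_coe_eq_abs_iff (1 : ℝ) one_ne_zero).2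
          (by rw [abs_mul, abs_of_pos hα0, abs_one]; linarith), abs_mul, abs_of_pos hα0] at h3
      have h4 : |(n : ℝ)| * α < ε * Λ.radius := h3.trans_le hrad.2
      rw [← hαN] at h4
      have h5 : |(n : ℝ)| < 2 * ε ^ 2 * Λ.length := by
        refine lt_of_mul_lt_mul_right (h4.trans_eq ?_) hα0.le
        ring
      nlinarith [mul_pos (pow_pos hε 2) hN0]
    · have h1 := hn.2 (Fin.castAdd 1 (Fin.castAdd _ j))
      have h2 := hn.2 (Fin.castAdd 1 (Fin.natAdd _ j))
      rw [hθ1] at h1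
      have h1' : ‖n • Λ.freq j‖ ≤ ε := (h1.le.trans hrad.2).trans hεr
      rw [hθ2, smul_comm, UnitAddCircle.norm_smul_eq _ _ (by rw [hKcast]; nlinarith), hKcast] at h2
      have h3 := h2.le.trans hrad.2
      have h4 : 1 / 4 * ‖n • Λ.freq j‖ ≤ ε * (ε * Λ.radius) :=
        calc 1 / 4 * ‖n • Λ.freq j‖ ≤ (K * ε) * ‖n • Λ.freq j‖ :=
              mul_le_mul_of_nonneg_right hKε' (norm_nonneg _)
          _ = ε * (K * ‖n • Λ.freq j‖) := by ring
          _ ≤ _ := mul_le_mul_of_nonneg_left h3 hε.le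
      nlinarith
  · intro n hnN hn
    have hε2pos : 0 < ε ^ 2 := by positivity
    have hR : ε * ε * Λ.radius ≤ Λ'.radius := by nlinarith [hrad.1, mul_pos hε hr0]
    have hN : ε * ε * Λ.length ≤ Λ'.length := by nlinarith [hlen.1, mul_pos hε hN0]
    have e1 : ε ^ 4 * Λ.radius ≤ ε ^ 2 * Λ'.radius := by
      calc ε ^ 4 * Λ.radius = ε ^ 2 * (ε * ε * Λ.radius) := by ring
        _ ≤ _ := mul_le_mul_of_nonneg_left hR hε2pos.le
    refine ⟨?_, fun j => ?_⟩
    · calc |(n : ℝ)| ≤ ε ^ 2 * (ε * ε * Λ.length) := hnN.trans_eq (by ring)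
        _ ≤ _ := mul_le_mul_of_nonneg_left hN hε2pos.le
    · have e2 : ε ^ 3 * Λ.radius / 2 ≤ ε ^ 2 * Λ'.radius := by
        calc ε ^ 3 * Λ.radius / 2 = ε ^ 2 * (ε * Λ.radius / 2) := by ring
          _ ≤ _ := mul_le_mul_of_nonneg_left hrad.1 hε2pos.le
      rw [hfreq]
      generalize Fin.cast hdim j = i
      refine Fin.addCases (fun i => ?_) (fun i => ?_) i
      · refine Fin.addCases (fun i => ?_) (fun i => ?_) i
        · rw [hθ1]; exact (hn i).trans e1
        · rw [hθ2, smul_comm]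
          have h1 : ‖(K : ℤ) • n • Λ.freq i‖ ≤ K * ‖n • Λ.freq i‖ := by
            simpa using norm_zsmul_le (K : ℤ) (n • Λ.freq i)
          refine h1.trans (le_trans ?_ e2)
          calc (K : ℝ) * ‖n • Λ.freq i‖ ≤ K * (ε ^ 4 * Λ.radius) :=
                mul_le_mul_of_nonneg_left (hn i) (by positivity)
            _ = (K * ε) * (ε ^ 3 * Λ.radius) := by ring
            _ ≤ 1 / 2 * (ε ^ 3 * Λ.radius) := mul_le_mul_of_nonneg_right hKε (by positivity)
            _ = _ := by ring
      · rw [hθ3]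
        refine (UnitAddCircle.norm_smul_coe_le _ _).trans (le_trans ?_ e2)
        rw [abs_of_pos hα0]
        calc |(n : ℝ)| * α ≤ ε ^ 4 * Λ.length * α := mul_le_mul_of_nonneg_right hnN hα0.le
          _ = ε ^ 3 * (α * Λ.length * (2 * ε)) / 2 := by ring
          _ = _ := by rw [hαN]

/-- `Λ'` is a regular Bohr set which has four dimensions more than `Λ`, on the scale `ε⁴`. -/
structure IsRefinement (ε : ℝ) (Λ Λ' : BohrDatum) : Prop where
  regular : Λ'.IsRegular
  dim_eq : Λ'.dim = Λ.dim + 4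
  radius : ε ^ 4 * Λ.radius / 2 ≤ Λ'.radius ∧ Λ'.radius ≤ ε ^ 4 * Λ.radius
  length : ε ^ 4 * Λ.length / 2 ≤ Λ'.length ∧ Λ'.length ≤ ε ^ 4 * Λ.length

/-- A refinement on which the additional frequency `x` is small.  The frequency is repeated four
times, since the loss of scale that is allowed in each dimension is only of the order of `ε`. -/
theorem exists_isRefinement (Λ : BohrDatum) (x : UnitAddCircle) {ε : ℝ} (hε : 0 < ε) :
    ∃ Λ', IsRefinement ε Λ Λ' ∧ ∀ n ∈ Λ'.carrier, |(n : ℝ)| ≤ ε ^ 4 * Λ.length ∧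
      (∀ j, ‖n • Λ.freq j‖ ≤ ε ^ 4 * Λ.radius) ∧ ‖n • x‖ ≤ ε ^ 4 * Λ.radius := by
  obtain ⟨Λ', hreg, ⟨hdim, hfreq⟩, hmem, hrad, hlen⟩ :=
    exists_regular_scale (d := Λ.dim + 4) (by omega) (Fin.append Λ.freq (fun _ : Fin 4 => x))
      (mul_pos (pow_pos hε 4) Λ.radius_pos) (mul_pos (pow_pos hε 4) Λ.length_pos)
  refine ⟨Λ', ⟨hreg, hdim, hrad, hlen⟩, fun n hn => ?_⟩
  rw [hmem] at hn
  refine ⟨hn.1.trans hlen.2, fun j => ?_, ?_⟩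
  · have := hn.2 (Fin.castAdd 4 j)
    rw [Fin.append_left] at this
    exact this.le.trans hrad.2
  · have := hn.2 (Fin.natAdd Λ.dim 0)
    rw [Fin.append_right] at this
    exact this.le.trans hrad.2

/-! ### Characters and finitely supported Fourier transforms -/

theorem norm_fourier_eq_one (n : ℤ) (x : UnitAddCircle) : ‖(fourier n x : ℂ)‖ = 1 := by
  rw [fourier_apply]; exact Circle.norm_coe _

theorem norm_fourier_sub_one_le (n : ℤ) (x : UnitAddCircle) :
    ‖(fourier n x : ℂ) - 1‖ ≤ 2 * Real.pi * ‖n • x‖ := by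
  obtain ⟨y, hy, hy'⟩ := UnitAddCircle.exists_real_rep (n • x)
  have h1 : (fourier n x : ℂ) = fourier 1 (y : UnitAddCircle) := by
    rw [fourier_apply, fourier_apply, hy, one_smul]
  rw [h1, fourier_coe_apply, ← hy']
  have h2 : (2 * Real.pi * Complex.I * ((1 : ℤ) : ℂ) * (y : ℂ) / ((1 : ℝ) : ℂ) : ℂ)
      = Complex.I * ((2 * Real.pi * y : ℝ) : ℂ) := by push_cast; ring
  rw [h2]
  refine (Real.norm_exp_I_mul_ofReal_sub_one_le).trans_eq ?_
  rw [Real.norm_eq_abs, abs_mul, abs_of_pos Real.two_pi_pos]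

theorem norm_fourier_neg_add_sub_le (n l : ℤ) (x : UnitAddCircle) :
    ‖(fourier (-(n + l)) x : ℂ) - fourier (-n) x‖ ≤ 2 * Real.pi * ‖l • x‖ := by
  rw [neg_add, fourier_add, ← mul_sub_one, norm_mul, norm_fourier_eq_one, one_mul]
  refine (norm_fourier_sub_one_le _ _).trans_eq ?_
  rw [neg_smul, norm_neg]

/-- The Fourier coefficient of the balanced function of `Q ∩ (S + m)` as a sum over `S`. -/
theorem fourierTransform_balanced (Q S : Finset ℤ) (m : ℤ) (δ : ℝ) (x : UnitAddCircle) :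
    fourierTransform (fun s => charFn (Q ∩ shiftSet S m) s - (δ : ℂ) * charFn (shiftSet S m) s) x
      = ∑ n ∈ S, ((((if m + n ∈ Q then 1 else 0 : ℝ) - δ : ℝ) : ℂ) * fourier (-(m + n)) x) := by
  have hmem : ∀ s, s ∉ shiftSet S m →
      (charFn (Q ∩ shiftSet S m) s - (δ : ℂ) * charFn (shiftSet S m) s) * fourier (-s) x = 0 := by
    intro s hs
    have : s ∉ Q ∩ shiftSet S m := fun h => hs (Finset.mem_inter.1 h).2
    simp [charFn, hs, this]
  rw [fourierTransform, tsum_eq_sum (s := shiftSet S m) (fun s hs => hmem s hs)]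
  rw [shiftSet, Finset.sum_image (fun a _ b _ h => by simpa using h)]
  refine Finset.sum_congr rfl fun n hn => ?_
  have h1 : n + m ∈ S.image (fun x => x + m) := Finset.mem_image_of_mem _ hn
  rw [add_comm m n]
  simp only [charFn, Finset.mem_inter, h1, and_true, if_true]
  split_ifs <;> simp

theorem exists_lt_norm_fourierTransform {f : ℤ → ℂ} {c : ℝ} (h : c < fourierSup f) :
    ∃ x, c < ‖fourierTransform f x‖ :=
  exists_lt_of_lt_ciSup h

/-! ### Averages -/

section Expect
variable {ι 𝕜 : Type*} [RCLike 𝕜]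

theorem norm_expect_le_expect_norm (s : Finset ι) (f : ι → 𝕜) :
    ‖𝔼 i ∈ s, f i‖ ≤ 𝔼 i ∈ s, ‖f i‖ := by
  rw [Finset.expect_eq_sum_div_card, Finset.expect_eq_sum_div_card, norm_div, RCLike.norm_natCast]
  gcongr
  exact norm_sum_le _ _

theorem norm_expect_sub_expect_le {s : Finset ι} (hs : s.Nonempty) {f g : ι → 𝕜} {c : ℝ}
    (h : ∀ i ∈ s, ‖f i - g i‖ ≤ c) : ‖(𝔼 i ∈ s, f i) - 𝔼 i ∈ s, g i‖ ≤ c := by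
  rw [← Finset.expect_sub_distrib]
  exact (norm_expect_le_expect_norm _ _).trans (Finset.expect_le hs h)

theorem abs_expect_sub_expect_le {s : Finset ι} (hs : s.Nonempty) {f g : ι → ℝ} {c : ℝ}
    (h : ∀ i ∈ s, |f i - g i| ≤ c) : |(𝔼 i ∈ s, f i) - 𝔼 i ∈ s, g i| ≤ c :=
  norm_expect_sub_expect_le (𝕜 := ℝ) hs h

theorem sq_expect_le_expect_sq {s : Finset ι} (hs : s.Nonempty) (f : ι → ℝ) :
    (𝔼 i ∈ s, f i) ^ 2 ≤ 𝔼 i ∈ s, f i ^ 2 := by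
  set a := 𝔼 i ∈ s, f i with ha
  have h : 𝔼 i ∈ s, (2 * a * f i - a ^ 2) ≤ 𝔼 i ∈ s, f i ^ 2 :=
    Finset.expect_le_expect fun i _ => by nlinarith [sq_nonneg (f i - a)]
  rw [Finset.expect_sub_distrib, ← Finset.mul_expect, Finset.expect_const hs, ← ha] at h
  nlinarith

end Expect

theorem AlmostInvariant.abs_sub_le {κ : ℝ} {B : Finset ℤ} {n : ℤ} (h : AlmostInvariant κ B n)
    {w : ℤ → ℝ} (hw : ∀ m, |w m| ≤ 1) : |(𝔼 m ∈ B, w (m + n)) - 𝔼 m ∈ B, w m| ≤ κ := by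
  have := h (fun m => (w m : ℂ)) (fun m => by simpa using hw m)
  simp only [Finset.expect_eq_sum_div_card] at this ⊢
  rw [← Real.norm_eq_abs, ← Complex.norm_real]
  simpa using this

theorem norm_expect_expect_add_sub_le {κ : ℝ} {B T : Finset ℤ} (hT : T.Nonempty)
    (h : ∀ l ∈ T, AlmostInvariant κ B l) {w : ℤ → ℂ} (hw : ∀ m, ‖w m‖ ≤ 1) :
    ‖(𝔼 m ∈ B, 𝔼 l ∈ T, w (m + l)) - 𝔼 m ∈ B, w m‖ ≤ κ := by
  rw [Finset.expect_comm]
  have := norm_expect_sub_expect_le hT (f := fun l => 𝔼 m ∈ B, w (m + l))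
    (g := fun _ => 𝔼 m ∈ B, w m) fun l hl => h l hl w hw
  rwa [Finset.expect_const hT] at this

theorem abs_expect_expect_add_sub_le {κ : ℝ} {B T : Finset ℤ} (hT : T.Nonempty)
    (h : ∀ l ∈ T, AlmostInvariant κ B l) {w : ℤ → ℝ} (hw : ∀ m, |w m| ≤ 1) :
    |(𝔼 m ∈ B, 𝔼 l ∈ T, w (m + l)) - 𝔼 m ∈ B, w m| ≤ κ := by
  rw [Finset.expect_comm]
  have := norm_expect_sub_expect_le hT (f := fun l => 𝔼 m ∈ B, w (m + l))
    (g := fun _ => 𝔼 m ∈ B, w m) fun l hl => (h l hl).abs_sub_le hw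
  rwa [Finset.expect_const hT] at this

/-! ### Passing to smaller sets

Throughout, a finite set `B` is replaced by the translates `m + n + T m` with `m ∈ B` and `n ∈ S`,
where the elements of `S` hardly move `B` and those of `T m` hardly move `B` and `S`.
-/

/-- The configuration of the refinement step: `B` is a Bohr set, `S` one of its attendants, and
`T m` is the still smaller Bohr set that is used near `m`. -/
structure RefinementSystem (κ : ℝ) (B S : Finset ℤ) (T : ℤ → Finset ℤ) : Prop where
  nonempty_base : B.Nonempty
  nonempty_mid : S.Nonempty
  nonempty_small : ∀ m, (T m).Nonempty
  base_mid : ∀ n ∈ S, AlmostInvariant κ B n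
  base_small : ∀ m, ∀ l ∈ T m, AlmostInvariant κ B l
  mid_small : ∀ m, ∀ l ∈ T m, AlmostInvariant κ S l

namespace RefinementSystem

variable {κ : ℝ} {B S : Finset ℤ} {T : ℤ → Finset ℤ}

theorem abs_expect_sub_le (h : RefinementSystem κ B S T) {v : ℤ → ℝ} (hv : ∀ m, |v m| ≤ 1) :
    |(𝔼 m ∈ B, 𝔼 n ∈ S, 𝔼 l ∈ T m, v (m + n + l)) - 𝔼 m ∈ B, v m| ≤ 2 * κ := by
  have h1 : |(𝔼 m ∈ B, 𝔼 n ∈ S, 𝔼 l ∈ T m, v (m + n + l)) - 𝔼 m ∈ B, 𝔼 n ∈ S, v (m + n)| ≤ κ := by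
    refine abs_expect_sub_expect_le h.nonempty_base fun m _ => ?_
    have := abs_expect_expect_add_sub_le (h.nonempty_small m) (h.mid_small m)
      (w := fun s => v (m + s)) (fun s => hv _)
    simpa only [add_assoc] using this
  have h2 := abs_expect_expect_add_sub_le h.nonempty_mid h.base_mid hv
  have h3 := abs_sub_le (𝔼 m ∈ B, 𝔼 n ∈ S, 𝔼 l ∈ T m, v (m + n + l))
    (𝔼 m ∈ B, 𝔼 n ∈ S, v (m + n)) (𝔼 m ∈ B, v m)
  linarith

theorem abs_expect_pair_sub_le (h : RefinementSystem κ B S T) {w : ℤ → ℤ → ℝ}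
    (hw : ∀ x y, |w x y| ≤ 1) :
    |(𝔼 m ∈ B, 𝔼 n ∈ S, 𝔼 k ∈ B, 𝔼 l ∈ T m, 𝔼 l' ∈ T m, w (m + n + l) (k + l'))
      - 𝔼 m ∈ B, 𝔼 k ∈ B, w m k| ≤ 3 * κ := by
  have h1 : |(𝔼 m ∈ B, 𝔼 n ∈ S, 𝔼 k ∈ B, 𝔼 l ∈ T m, 𝔼 l' ∈ T m, w (m + n + l) (k + l'))
      - 𝔼 m ∈ B, 𝔼 n ∈ S, 𝔼 l ∈ T m, 𝔼 k ∈ B, w (m + n + l) k| ≤ κ := by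
    refine abs_expect_sub_expect_le h.nonempty_base fun m _ =>
      abs_expect_sub_expect_le h.nonempty_mid fun n _ => ?_
    rw [Finset.expect_comm]
    exact abs_expect_sub_expect_le (h.nonempty_small m) fun l _ =>
      abs_expect_expect_add_sub_le (h.nonempty_small m) (h.base_small m) (hw _)
  have h2 := h.abs_expect_sub_le (v := fun x => 𝔼 k ∈ B, w x k) fun x =>
    (Finset.abs_expect_le _ _).trans (Finset.expect_le h.nonempty_base fun k _ => hw x k)
  have h3 := abs_sub_le (𝔼 m ∈ B, 𝔼 n ∈ S, 𝔼 k ∈ B, 𝔼 l ∈ T m, 𝔼 l' ∈ T m, w (m + n + l) (k + l'))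
    (𝔼 m ∈ B, 𝔼 n ∈ S, 𝔼 l ∈ T m, 𝔼 k ∈ B, w (m + n + l) k) (𝔼 m ∈ B, 𝔼 k ∈ B, w m k)
  linarith

/-- The mean square deviation from `δ` of the densities of `u` on the sets `m + n + T m`. -/
noncomputable def deviation (B S : Finset ℤ) (T : ℤ → Finset ℤ) (u : ℤ → ℝ) (δ : ℝ) : ℝ :=
  𝔼 m ∈ B, 𝔼 n ∈ S, ((𝔼 l ∈ T m, u (m + n + l)) - δ) ^ 2

theorem le_expect_sq (h : RefinementSystem κ B S T) {u : ℤ → ℝ} (hu : ∀ m, 0 ≤ u m ∧ u m ≤ 1)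
    {δ : ℝ} (hδ : 𝔼 m ∈ B, u m = δ) :
    δ ^ 2 + deviation B S T u δ - 4 * κ ≤ 𝔼 m ∈ B, 𝔼 n ∈ S, (𝔼 l ∈ T m, u (m + n + l)) ^ 2 := by
  have hδ0 : 0 ≤ δ := hδ ▸ Finset.expect_nonneg fun m _ => (hu m).1
  have hδ1 : δ ≤ 1 := hδ ▸ Finset.expect_le h.nonempty_base fun m _ => (hu m).2
  have h1 := h.abs_expect_sub_le (v := u) (fun m => abs_le.2 ⟨by linarith [hu m], (hu m).2⟩)
  rw [hδ] at h1
  have hκ : 0 ≤ κ := by linarith [abs_nonneg ((𝔼 m ∈ B, 𝔼 n ∈ S, 𝔼 l ∈ T m, u (m + n + l)) - δ)]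
  have h2 : 𝔼 m ∈ B, 𝔼 n ∈ S, (𝔼 l ∈ T m, u (m + n + l)) ^ 2 = deviation B S T u δ
      + (2 * δ * (𝔼 m ∈ B, 𝔼 n ∈ S, 𝔼 l ∈ T m, u (m + n + l)) - δ ^ 2) := by
    have : ∀ m n, (𝔼 l ∈ T m, u (m + n + l)) ^ 2 = ((𝔼 l ∈ T m, u (m + n + l)) - δ) ^ 2
        + (2 * δ * (𝔼 l ∈ T m, u (m + n + l)) - δ ^ 2) := fun m n => by ring
    simp_rw [this]
    simp only [Finset.expect_add_distrib, Finset.expect_sub_distrib, ← Finset.mul_expect,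
      Finset.expect_const h.nonempty_mid, Finset.expect_const h.nonempty_base, deviation]
  rw [h2]
  have h3 := (abs_le.1 h1).1
  nlinarith

theorem le_expect_sq' (h : RefinementSystem κ B S T) {u : ℤ → ℝ} (hu : ∀ m, 0 ≤ u m ∧ u m ≤ 1)
    {δ : ℝ} (hδ : 𝔼 m ∈ B, u m = δ) (m : ℤ) :
    δ ^ 2 - 2 * κ ≤ 𝔼 k ∈ B, (𝔼 l ∈ T m, u (k + l)) ^ 2 := by
  have hδ0 : 0 ≤ δ := hδ ▸ Finset.expect_nonneg fun m _ => (hu m).1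
  have hδ1 : δ ≤ 1 := hδ ▸ Finset.expect_le h.nonempty_base fun m _ => (hu m).2
  have h1 := abs_expect_expect_add_sub_le (h.nonempty_small m) (h.base_small m) (w := u)
    (fun m => abs_le.2 ⟨by linarith [hu m], (hu m).2⟩)
  rw [hδ] at h1
  have h2 := sq_expect_le_expect_sq h.nonempty_base (fun k => 𝔼 l ∈ T m, u (k + l))
  have h3 := (abs_le.1 h1).1
  have hκ := (abs_nonneg _).trans h1
  have h4 : δ ^ 2 - 2 * κ ≤ (𝔼 k ∈ B, 𝔼 l ∈ T m, u (k + l)) ^ 2 := by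
    nlinarith [sq_nonneg ((𝔼 k ∈ B, 𝔼 l ∈ T m, u (k + l)) - δ)]
  linarith

/-- On average over the smaller sets, a bounded function of two variables keeps its mean, while the
sum of the squared densities increases by the deviation. -/
theorem exists_le (h : RefinementSystem κ B S T) {w : ℤ → ℤ → ℝ} (hw : ∀ x y, |w x y| ≤ 1)
    {u₁ u₂ : ℤ → ℝ} (hu₁ : ∀ m, 0 ≤ u₁ m ∧ u₁ m ≤ 1) (hu₂ : ∀ m, 0 ≤ u₂ m ∧ u₂ m ≤ 1)
    {μ : ℝ} (hμ : 0 ≤ μ) :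
    ∃ m ∈ B, ∃ n ∈ S, ∃ k ∈ B,
      μ * ((𝔼 x ∈ B, 𝔼 y ∈ B, w x y) - 3 * κ) + (𝔼 x ∈ B, u₁ x) ^ 2 + (𝔼 x ∈ B, u₂ x) ^ 2
          + (deviation B S T u₁ (𝔼 x ∈ B, u₁ x) - 6 * κ)
        ≤ μ * (𝔼 l ∈ T m, 𝔼 l' ∈ T m, w (m + n + l) (k + l'))
          + (𝔼 l ∈ T m, u₁ (m + n + l)) ^ 2 + (𝔼 l ∈ T m, u₂ (k + l)) ^ 2 := by
  have h1 := h.abs_expect_pair_sub_le hw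
  have h2 := h.le_expect_sq hu₁ rfl
  have h3 : (𝔼 x ∈ B, u₂ x) ^ 2 - 2 * κ ≤ 𝔼 m ∈ B, 𝔼 n ∈ S, 𝔼 k ∈ B, (𝔼 l ∈ T m, u₂ (k + l)) ^ 2 :=
    Finset.le_expect h.nonempty_base fun m _ => Finset.le_expect h.nonempty_mid fun n _ =>
      h.le_expect_sq' hu₂ rfl m
  have h4 := mul_le_mul_of_nonneg_left (sub_le_comm.1 (abs_sub_le_iff.1 h1).2) hμ
  obtain ⟨m, hm, hm'⟩ := Finset.exists_le_of_le_expect h.nonempty_base (f := fun m =>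
    𝔼 n ∈ S, 𝔼 k ∈ B, (μ * (𝔼 l ∈ T m, 𝔼 l' ∈ T m, w (m + n + l) (k + l'))
          + (𝔼 l ∈ T m, u₁ (m + n + l)) ^ 2 + (𝔼 l ∈ T m, u₂ (k + l)) ^ 2))
    (a := μ * ((𝔼 x ∈ B, 𝔼 y ∈ B, w x y) - 3 * κ) + (𝔼 x ∈ B, u₁ x) ^ 2 + (𝔼 x ∈ B, u₂ x) ^ 2
          + (deviation B S T u₁ (𝔼 x ∈ B, u₁ x) - 6 * κ)) (by
      simp only [Finset.expect_add_distrib, ← Finset.mul_expect, Finset.expect_const h.nonempty_base]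
      linarith)
  obtain ⟨n, hn, hn'⟩ := Finset.exists_le_of_le_expect h.nonempty_mid hm'
  obtain ⟨k, hk, hk'⟩ := Finset.exists_le_of_le_expect h.nonempty_base hn'
  exact ⟨m, hm, n, hn, k, hk, hk'⟩

end RefinementSystem

/-! ### Lower bounds for the deviation -/

/-- A large Fourier coefficient forces large averages over the translates of a set on which the
character `χ` is almost constant. -/
theorem norm_expect_mul_le {κ : ℝ} {S T : Finset ℤ} (hS : S.Nonempty) (hT : T.Nonempty)
    (h : ∀ l ∈ T, AlmostInvariant κ S l) {v : ℤ → ℝ} (hv : ∀ n, |v n| ≤ 1) {χ : ℤ → ℂ}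
    (hχ : ∀ n, ‖χ n‖ = 1) (hχT : ∀ l ∈ T, ∀ n, ‖χ (n + l) - χ n‖ ≤ κ) :
    ‖𝔼 n ∈ S, (v n : ℂ) * χ n‖ ≤ (𝔼 n ∈ S, |𝔼 l ∈ T, v (n + l)|) + 2 * κ := by
  have hvc : ∀ n, ‖(v n : ℂ)‖ ≤ 1 := fun n => by simpa using hv n
  have h1 := norm_expect_expect_add_sub_le hT h (w := fun n => (v n : ℂ) * χ n)
    (fun n => by rw [norm_mul, hχ, mul_one]; exact hvc n)
  have h2 : ‖(𝔼 n ∈ S, 𝔼 l ∈ T, (v (n + l) : ℂ) * χ (n + l))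
      - 𝔼 n ∈ S, 𝔼 l ∈ T, (v (n + l) : ℂ) * χ n‖ ≤ κ := by
    refine norm_expect_sub_expect_le hS fun n _ => norm_expect_sub_expect_le hT fun l hl => ?_
    rw [← mul_sub, norm_mul]
    calc _ ≤ 1 * κ := mul_le_mul (hvc _) (hχT l hl n) (norm_nonneg _) zero_le_one
      _ = κ := one_mul _
  have h3 : ‖𝔼 n ∈ S, 𝔼 l ∈ T, (v (n + l) : ℂ) * χ n‖ ≤ 𝔼 n ∈ S, |𝔼 l ∈ T, v (n + l)| := by
    refine (norm_expect_le_expect_norm _ _).trans (Finset.expect_le_expect fun n _ => ?_)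
    rw [← Finset.expect_mul, norm_mul, hχ, mul_one, ← Real.norm_eq_abs, ← Complex.norm_real]
    simp [Finset.expect_eq_sum_div_card]
  set X := 𝔼 n ∈ S, (v n : ℂ) * χ n
  set Y := 𝔼 n ∈ S, 𝔼 l ∈ T, (v (n + l) : ℂ) * χ (n + l)
  set Z := 𝔼 n ∈ S, 𝔼 l ∈ T, (v (n + l) : ℂ) * χ n
  have h4 : X = Z + (Y - Z) - (Y - X) := by ring
  rw [h4]
  have h5 := norm_sub_le (Z + (Y - Z)) (Y - X)
  have h6 := norm_add_le Z (Y - Z)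
  linarith

namespace RefinementSystem

variable {κ : ℝ} {B S : Finset ℤ} {T : ℤ → Finset ℤ}

/-- Few of the translates `m + S` with `m ∈ B` leave `B`. -/
theorem expect_overflow_le (h : RefinementSystem κ B S T) :
    𝔼 m ∈ B, 𝔼 n ∈ S, (1 - if m + n ∈ B then 1 else 0 : ℝ) ≤ κ := by
  have h1 := abs_expect_expect_add_sub_le h.nonempty_mid h.base_mid
    (w := fun s => if s ∈ B then (1 : ℝ) else 0) (fun m => by split_ifs <;> simp)
  have h2 : 𝔼 m ∈ B, (if m ∈ B then (1 : ℝ) else 0) = 1 := by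
    rw [Finset.expect_congr rfl (g := fun _ => (1 : ℝ)) (fun m hm => by simp [hm]),
      Finset.expect_const h.nonempty_base]
  rw [h2] at h1
  simp only [Finset.expect_sub_distrib, Finset.expect_const h.nonempty_base,
    Finset.expect_const h.nonempty_mid]
  linarith [(abs_le.1 h1).1]

theorem norm_expect_inter_sub_le {Q : Finset ℤ} {u : ℤ → ℝ}
    (hu : ∀ s, 0 ≤ u s ∧ u s ≤ 1) (hQ : ∀ s ∈ B, u s = if s ∈ Q then 1 else 0) (hQB : Q ⊆ B)
    (m : ℤ) {c : ℤ → ℂ} (hc : ∀ n, ‖c n‖ = 1) (δ : ℝ) :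
    ‖(𝔼 n ∈ S, ((((if m + n ∈ Q then 1 else 0 : ℝ) - δ : ℝ) : ℂ) * c n))
      - 𝔼 n ∈ S, (((u (m + n) - δ : ℝ) : ℂ) * c n)‖
      ≤ 𝔼 n ∈ S, (1 - if m + n ∈ B then 1 else 0 : ℝ) := by
  rw [← Finset.expect_sub_distrib]
  refine (norm_expect_le_expect_norm _ _).trans (Finset.expect_le_expect fun n _ => ?_)
  rw [← sub_mul, norm_mul, hc, mul_one, ← Complex.ofReal_sub, Complex.norm_real, Real.norm_eq_abs]
  by_cases hB : m + n ∈ B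
  · simp [hB, hQ _ hB]
  · have : m + n ∉ Q := fun hh => hB (hQB hh)
    have hh := hu (m + n)
    simp only [hB, this, if_false]
    rw [abs_le]; constructor <;> linarith

/-- The case of local Fourier uniformity: `Z` is the set of bad shifts and `χ m` the character that
is responsible for the shift `m`. -/
theorem le_deviation_of_local_fourier (h : RefinementSystem κ B S T) {Q : Finset ℤ} {u : ℤ → ℝ}
    (hu : ∀ s, 0 ≤ u s ∧ u s ≤ 1) (hQ : ∀ s ∈ B, u s = if s ∈ Q then 1 else 0) (hQB : Q ⊆ B)
    {δ : ℝ} (hδ : 0 ≤ δ ∧ δ ≤ 1) {χ : ℤ → ℤ → ℂ} (hχ : ∀ m n, ‖χ m n‖ = 1)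
    (hχT : ∀ m, ∀ l ∈ T m, ∀ n, ‖χ m (n + l) - χ m n‖ ≤ κ) {σ : ℝ} (hσ : σ ≤ 1) (hκ0 : 0 ≤ κ)
    (hκ : 4 * κ ≤ σ) {Z : Finset ℤ} (hZ : Z ⊆ B) (hZcard : σ * (B.card : ℝ) ≤ Z.card)
    (hlarge : ∀ m ∈ Z,
      σ / 2 ≤ ‖𝔼 n ∈ S, ((((if m + n ∈ Q then 1 else 0 : ℝ) - δ : ℝ) : ℂ) * χ m n)‖) :
    σ * (σ / 2 - 2 * κ) ^ 2 - 2 * κ ≤ deviation B S T u δ := by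
  set r : ℤ → ℝ := fun m => 𝔼 n ∈ S, (1 - if m + n ∈ B then 1 else 0 : ℝ) with hr
  set V : ℤ → ℝ := fun m => 𝔼 n ∈ S, ((𝔼 l ∈ T m, u (m + n + l)) - δ) ^ 2 with hV
  have hr0 : ∀ m, 0 ≤ r m := fun m => Finset.expect_nonneg fun n _ => by split_ifs <;> simp
  have hV0 : ∀ m, 0 ≤ V m := fun m => Finset.expect_nonneg fun n _ => sq_nonneg _
  have hmean : 𝔼 m ∈ B, r m ≤ κ := h.expect_overflow_le
  have hpt : ∀ m ∈ Z, (σ / 2 - 2 * κ) ^ 2 ≤ V m + 2 * r m := by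
    intro m hm
    have h1 := norm_expect_inter_sub_le (S := S) hu hQ hQB m (hχ m) δ
    have h2 := norm_expect_mul_le h.nonempty_mid (h.nonempty_small m) (h.mid_small m)
      (v := fun n => u (m + n) - δ)
      (fun n => abs_le.2 ⟨by linarith [hu (m + n)], by linarith [hu (m + n)]⟩) (hχ m) (hχT m)
    have h3 := hlarge m hm
    have h4 := norm_sub_norm_le
      (𝔼 n ∈ S, ((((if m + n ∈ Q then 1 else 0 : ℝ) - δ : ℝ) : ℂ) * χ m n))
      (𝔼 n ∈ S, (((u (m + n) - δ : ℝ) : ℂ) * χ m n))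
    have h5 : ∀ n, 𝔼 l ∈ T m, (u (m + (n + l)) - δ) = (𝔼 l ∈ T m, u (m + n + l)) - δ := fun n => by
      rw [Finset.expect_sub_distrib, Finset.expect_const (h.nonempty_small m)]
      simp only [add_assoc]
    simp only [h5] at h2
    set y := 𝔼 n ∈ S, |(𝔼 l ∈ T m, u (m + n + l)) - δ| with hy
    have h6 : y ^ 2 ≤ V m := by
      have := sq_expect_le_expect_sq h.nonempty_mid (fun n => |(𝔼 l ∈ T m, u (m + n + l)) - δ|)
      simpa only [sq_abs] using this
    have h7 : σ / 2 - 2 * κ ≤ y + r m := by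
      have : ‖_‖ ≤ r m := h1
      linarith
    have h8 := hr0 m
    have h9 : 0 ≤ y := Finset.expect_nonneg fun n _ => abs_nonneg _
    -- `y² ≥ c² - 2 r` follows from `y ≥ c - r` for `0 ≤ c ≤ 1`
    nlinarith [sq_nonneg (y - (σ / 2 - 2 * κ)), mul_nonneg h8 h9]
  have hsum : (Z.card : ℝ) * (σ / 2 - 2 * κ) ^ 2 ≤ ∑ m ∈ B, (V m + 2 * r m) := by
    calc (Z.card : ℝ) * (σ / 2 - 2 * κ) ^ 2 = ∑ m ∈ Z, (σ / 2 - 2 * κ) ^ 2 := by simp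
      _ ≤ ∑ m ∈ Z, (V m + 2 * r m) := Finset.sum_le_sum hpt
      _ ≤ _ := Finset.sum_le_sum_of_subset_of_nonneg hZ fun m _ _ => by
          linarith [hV0 m, hr0 m]
  have hBpos : (0 : ℝ) < B.card := by exact_mod_cast h.nonempty_base.card_pos
  have hexp : σ * (σ / 2 - 2 * κ) ^ 2 ≤ 𝔼 m ∈ B, (V m + 2 * r m) := by
    rw [Finset.expect_eq_sum_div_card, le_div_iff₀ hBpos]
    nlinarith [sq_nonneg (σ / 2 - 2 * κ)]
  rw [Finset.expect_add_distrib, ← Finset.mul_expect] at hexp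
  have : deviation B S T u δ = 𝔼 m ∈ B, V m := rfl
  linarith

/-- The case of the local densities: by convexity, the densities on the smaller sets deviate at
least as much as those on the sets `m + S`. -/
theorem le_deviation_of_local_density (h : RefinementSystem κ B S T) {Q : Finset ℤ} {u : ℤ → ℝ}
    (hu : ∀ s, 0 ≤ u s ∧ u s ≤ 1) (hQ : ∀ s ∈ B, u s = if s ∈ Q then 1 else 0) (hQB : Q ⊆ B)
    {δ : ℝ} (hδ : 0 ≤ δ ∧ δ ≤ 1) {σ : ℝ}
    (hlarge : σ ^ 2 ≤ 𝔼 m ∈ B, |(𝔼 n ∈ S, (if m + n ∈ Q then 1 else 0 : ℝ)) - δ| ^ 2) :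
    σ ^ 2 - 4 * κ ≤ deviation B S T u δ := by
  set r : ℤ → ℝ := fun m => 𝔼 n ∈ S, (1 - if m + n ∈ B then 1 else 0 : ℝ) with hr
  have hmean : 𝔼 m ∈ B, r m ≤ κ := h.expect_overflow_le
  have hpt : ∀ m ∈ B, |(𝔼 n ∈ S, (if m + n ∈ Q then 1 else 0 : ℝ)) - δ| ^ 2
      ≤ (𝔼 n ∈ S, ((𝔼 l ∈ T m, u (m + n + l)) - δ) ^ 2) + 2 * κ + 2 * r m := by
    intro m _
    rw [sq_abs]
    set x := 𝔼 n ∈ S, (if m + n ∈ Q then 1 else 0 : ℝ) with hx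
    set y := 𝔼 n ∈ S, u (m + n) with hy
    set z := 𝔼 n ∈ S, 𝔼 l ∈ T m, u (m + n + l) with hz
    have hxy : |x - y| ≤ r m := by
      rw [hx, hy, ← Finset.expect_sub_distrib]
      refine (Finset.abs_expect_le _ _).trans (Finset.expect_le_expect fun n _ => ?_)
      by_cases hB : m + n ∈ B
      · simp [hB, hQ _ hB]
      · have : m + n ∉ Q := fun hh => hB (hQB hh)
        have hh := hu (m + n)
        simp only [hB, this, if_false]
        rw [abs_le]; constructor <;> linarith
    have hzy : |z - y| ≤ κ := by
      have := abs_expect_expect_add_sub_le (h.nonempty_small m) (h.mid_small m)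
        (w := fun s => u (m + s)) (fun s => abs_le.2 ⟨by linarith [hu (m + s)], (hu _).2⟩)
      rw [hz, hy]
      simpa only [add_assoc] using this
    have hx01 : 0 ≤ x ∧ x ≤ 1 := ⟨Finset.expect_nonneg fun n _ => by split_ifs <;> simp,
      Finset.expect_le h.nonempty_mid fun n _ => by split_ifs <;> simp⟩
    have hz01 : 0 ≤ z ∧ z ≤ 1 := ⟨Finset.expect_nonneg fun n _ => Finset.expect_nonneg fun l _ =>
      (hu _).1, Finset.expect_le h.nonempty_mid fun n _ =>
      Finset.expect_le (h.nonempty_small m) fun l _ => (hu _).2⟩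
    have hzsq : (z - δ) ^ 2 ≤ 𝔼 n ∈ S, ((𝔼 l ∈ T m, u (m + n + l)) - δ) ^ 2 := by
      have := sq_expect_le_expect_sq h.nonempty_mid (fun n => (𝔼 l ∈ T m, u (m + n + l)) - δ)
      rwa [Finset.expect_sub_distrib, Finset.expect_const h.nonempty_mid] at this
    have hxz : |x - z| ≤ r m + κ := by
      have := abs_sub_le x y z
      rw [abs_sub_comm y z] at this
      linarith
    have hprod : (x - δ) ^ 2 - (z - δ) ^ 2 ≤ 2 * |x - z| := by
      have e : (x - δ) ^ 2 - (z - δ) ^ 2 = (x - z) * (x + z - 2 * δ) := by ring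
      rw [e]
      refine (le_abs_self _).trans ?_
      rw [abs_mul, mul_comm]
      refine mul_le_mul_of_nonneg_right (abs_le.2 ⟨?_, ?_⟩) (abs_nonneg _) <;> linarith
    linarith
  have := hlarge.trans (Finset.expect_le_expect hpt)
  rw [Finset.expect_add_distrib, Finset.expect_add_distrib, Finset.expect_const h.nonempty_base,
    ← Finset.mul_expect] at this
  have e : deviation B S T u δ = 𝔼 m ∈ B, 𝔼 n ∈ S, ((𝔼 l ∈ T m, u (m + n + l)) - δ) ^ 2 := rfl
  linarith

/-- The case of global Fourier uniformity: a single character, hence a single smaller set,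
suffices. -/
theorem le_deviation_of_global_fourier {T₀ : Finset ℤ} (h : RefinementSystem κ B S (fun _ => T₀))
    {u : ℤ → ℝ} (hu : ∀ s, 0 ≤ u s ∧ u s ≤ 1) {δ : ℝ} (hδ : 0 ≤ δ ∧ δ ≤ 1) {χ : ℤ → ℂ}
    (hχ : ∀ n, ‖χ n‖ = 1) (hχT : ∀ l ∈ T₀, ∀ n, ‖χ (n + l) - χ n‖ ≤ κ) {σ : ℝ} (hσ : 3 * κ ≤ σ)
    (hlarge : σ ≤ ‖𝔼 s ∈ B, (((u s - δ : ℝ) : ℂ) * χ s)‖) :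
    (σ - 3 * κ) ^ 2 ≤ deviation B S (fun _ => T₀) u δ := by
  have hT := h.nonempty_small 0
  have h1 := norm_expect_mul_le h.nonempty_base hT (h.base_small 0) (v := fun s => u s - δ)
    (fun n => abs_le.2 ⟨by linarith [hu n], by linarith [hu n]⟩) hχ hχT
  set f : ℤ → ℝ := fun s => |(𝔼 l ∈ T₀, u (s + l)) - δ| with hf
  have h5 : ∀ n, |𝔼 l ∈ T₀, (u (n + l) - δ)| = f n := fun n => by
    rw [Finset.expect_sub_distrib, Finset.expect_const hT]
  simp only [h5] at h1
  have hf1 : ∀ s, |f s| ≤ 1 := fun s => by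
    have a : 0 ≤ 𝔼 l ∈ T₀, u (s + l) := Finset.expect_nonneg fun l _ => (hu _).1
    have b : 𝔼 l ∈ T₀, u (s + l) ≤ 1 := Finset.expect_le hT fun l _ => (hu _).2
    rw [hf, abs_abs, abs_le]
    constructor <;> linarith
  have h2 := abs_expect_expect_add_sub_le h.nonempty_mid h.base_mid hf1
  have h3 : σ - 3 * κ ≤ 𝔼 m ∈ B, 𝔼 n ∈ S, f (m + n) := by linarith [(abs_le.1 h2).1]
  calc (σ - 3 * κ) ^ 2 ≤ (𝔼 m ∈ B, 𝔼 n ∈ S, f (m + n)) ^ 2 :=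
        pow_le_pow_left₀ (by linarith) h3 2
    _ ≤ 𝔼 m ∈ B, (𝔼 n ∈ S, f (m + n)) ^ 2 := sq_expect_le_expect_sq h.nonempty_base _
    _ ≤ 𝔼 m ∈ B, 𝔼 n ∈ S, f (m + n) ^ 2 :=
        Finset.expect_le_expect fun m _ => sq_expect_le_expect_sq h.nonempty_mid _
    _ = _ := by simp only [hf, sq_abs, deviation]

end RefinementSystem

/-! ### Densities on translates -/

/-- The indicator function of a finite set, with real values. -/
def setInd {α : Type*} [DecidableEq α] (E : Finset α) (s : α) : ℝ := if s ∈ E then 1 else 0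

theorem setInd_mem_Icc {α : Type*} [DecidableEq α] (E : Finset α) (s : α) :
    0 ≤ setInd E s ∧ setInd E s ≤ 1 := by
  unfold setInd; split_ifs <;> simp

/-- The density of `E` on `B + t`. -/
noncomputable def shiftDensity (E B : Finset ℤ) (t : ℤ) : ℝ := 𝔼 x ∈ B, setInd E (t + x)

/-- The mean of `w` over `(B + t₁) × (B + t₂)`. -/
noncomputable def boxMean (w : ℤ → ℤ → ℝ) (B : Finset ℤ) (t₁ t₂ : ℤ) : ℝ :=
  𝔼 x ∈ B, 𝔼 y ∈ B, w (t₁ + x) (t₂ + y)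

theorem boxMean_swap (w : ℤ → ℤ → ℝ) (B : Finset ℤ) (t₁ t₂ : ℤ) :
    boxMean (fun x y => w y x) B t₂ t₁ = boxMean w B t₁ t₂ :=
  Finset.expect_comm _ _ _

theorem shiftDensity_mem_Icc {E B : Finset ℤ} (hB : B.Nonempty) (t : ℤ) :
    0 ≤ shiftDensity E B t ∧ shiftDensity E B t ≤ 1 :=
  ⟨Finset.expect_nonneg fun _ _ => (setInd_mem_Icc E _).1,
    Finset.expect_le hB fun _ _ => (setInd_mem_Icc E _).2⟩

theorem mem_shiftSet_neg {E : Finset ℤ} {s t : ℤ} : s ∈ shiftSet E (-t) ↔ t + s ∈ E := by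
  simp only [shiftSet, Finset.mem_image]
  exact ⟨fun ⟨x, hx, h⟩ => by rw [← h]; simpa using hx, fun h => ⟨t + s, h, by ring⟩⟩

theorem mem_shiftPairs_neg {A : Finset (ℤ × ℤ)} {x y t₁ t₂ : ℤ} :
    (x, y) ∈ shiftPairs A (-t₁) (-t₂) ↔ (t₁ + x, t₂ + y) ∈ A := by
  simp only [shiftPairs, Finset.mem_image, Prod.mk.injEq]
  constructor
  · rintro ⟨⟨a, b⟩, hp, h1, h2⟩
    rw [← h1, ← h2]; simpa using hp
  · exact fun h => ⟨_, h, by ring, by ring⟩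

theorem card_shiftSet (S : Finset ℤ) (m : ℤ) : (shiftSet S m).card = S.card :=
  Finset.card_image_of_injective _ (add_left_injective m)

theorem card_shiftSet_inter (E B : Finset ℤ) (t : ℤ) :
    ((shiftSet E (-t) ∩ B).card : ℝ) = B.card * shiftDensity E B t := by
  have h : shiftSet E (-t) ∩ B = B.filter (fun x => t + x ∈ E) := by
    ext x
    rw [Finset.mem_inter, Finset.mem_filter, mem_shiftSet_neg, and_comm]
  rw [shiftDensity, Finset.card_mul_expect, h]
  simp [setInd]

theorem relDensity_shiftSet (S Q : Finset ℤ) (m : ℤ) :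
    relDensity (shiftSet S m) Q = 𝔼 n ∈ S, (if m + n ∈ Q then 1 else 0 : ℝ) := by
  have h : Q ∩ shiftSet S m = (S.filter (fun n => m + n ∈ Q)).image (fun n => n + m) := by
    ext x
    simp only [shiftSet, Finset.mem_inter, Finset.mem_image, Finset.mem_filter]
    constructor
    · rintro ⟨hx, n, hn, rfl⟩
      exact ⟨n, ⟨hn, by rwa [add_comm]⟩, rfl⟩
    · rintro ⟨n, ⟨hn, hq⟩, rfl⟩
      exact ⟨by rwa [add_comm], n, hn, rfl⟩
  rw [relDensity, card_shiftSet, h, Finset.card_image_of_injective _ (add_left_injective m),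
    Finset.expect_eq_sum_div_card]
  simp

theorem shiftSet_zero (S : Finset ℤ) : shiftSet S 0 = S := by simp [shiftSet]

theorem relDensity_shiftSet_inter (E B : Finset ℤ) (t : ℤ) :
    relDensity B (shiftSet E (-t) ∩ B) = shiftDensity E B t := by
  rcases B.eq_empty_or_nonempty with rfl | hB
  · simp [relDensity, shiftDensity]
  have : (0 : ℝ) < B.card := by exact_mod_cast hB.card_pos
  rw [relDensity, Finset.inter_assoc, Finset.inter_self, card_shiftSet_inter]
  field_simp

theorem card_shiftPairs_inter {A : Finset (ℤ × ℤ)} {E₁ E₂ : Finset ℤ} (hA : A ⊆ E₁ ×ˢ E₂)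
    (B : Finset ℤ) (t₁ t₂ : ℤ) :
    ((shiftPairs A (-t₁) (-t₂) ∩ ((shiftSet E₁ (-t₁) ∩ B) ×ˢ (shiftSet E₂ (-t₂) ∩ B))).card : ℝ)
      = B.card ^ 2 * boxMean (fun x y => setInd A (x, y)) B t₁ t₂ := by
  have h : shiftPairs A (-t₁) (-t₂) ∩ ((shiftSet E₁ (-t₁) ∩ B) ×ˢ (shiftSet E₂ (-t₂) ∩ B))
      = (B ×ˢ B).filter (fun p => (t₁ + p.1, t₂ + p.2) ∈ A) := by
    ext ⟨x, y⟩
    simp only [Finset.mem_inter, Finset.mem_product, Finset.mem_filter, mem_shiftPairs_neg,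
      mem_shiftSet_neg]
    constructor
    · rintro ⟨h, ⟨-, hx⟩, -, hy⟩
      exact ⟨⟨hx, hy⟩, h⟩
    · rintro ⟨⟨hx, hy⟩, h⟩
      have := Finset.mem_product.1 (hA h)
      exact ⟨h, ⟨this.1, hx⟩, this.2, hy⟩
  rw [h, boxMean, sq, mul_assoc, Finset.mul_expect, Finset.card_mul_expect]
  simp only [Finset.card_mul_expect]
  rw [← Finset.sum_product']
  simp [setInd]

/-! ### The balanced weight

The weight `1_A - γ 1_{E₁ × E₂}`: its mean on a box is positive only if `A` has relative density
larger than `γ` there. -/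

/-- The function `1_A - γ 1_{E₁ × E₂}`. -/
def balancedWeight (A : Finset (ℤ × ℤ)) (E₁ E₂ : Finset ℤ) (γ : ℝ) (x y : ℤ) : ℝ :=
  setInd A (x, y) - γ * (setInd E₁ x * setInd E₂ y)

section Weight
variable {A : Finset (ℤ × ℤ)} {E₁ E₂ : Finset ℤ} {γ : ℝ}

theorem setInd_le_mul (hA : A ⊆ E₁ ×ˢ E₂) (x y : ℤ) :
    setInd A (x, y) ≤ setInd E₁ x * setInd E₂ y := by
  by_cases h : (x, y) ∈ A
  · have := Finset.mem_product.1 (hA h)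
    simp [setInd, h, this.1, this.2]
  · have := mul_nonneg (setInd_mem_Icc E₁ x).1 (setInd_mem_Icc E₂ y).1
    simpa [setInd, h] using this

theorem abs_balancedWeight_le (hγ0 : 0 ≤ γ) (hγ1 : γ ≤ 1) (x y : ℤ) :
    |balancedWeight A E₁ E₂ γ x y| ≤ 1 := by
  have h1 := setInd_mem_Icc A (x, y)
  have h2 := mul_nonneg (setInd_mem_Icc E₁ x).1 (setInd_mem_Icc E₂ y).1
  have h3 := mul_le_one₀ (setInd_mem_Icc E₁ x).2 (setInd_mem_Icc E₂ y).1 (setInd_mem_Icc E₂ y).2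
  unfold balancedWeight
  rw [abs_le]; constructor <;> nlinarith

theorem boxMean_balancedWeight (B : Finset ℤ) (t₁ t₂ : ℤ) :
    boxMean (balancedWeight A E₁ E₂ γ) B t₁ t₂
      = boxMean (fun x y => setInd A (x, y)) B t₁ t₂
        - γ * (shiftDensity E₁ B t₁ * shiftDensity E₂ B t₂) := by
  simp only [boxMean, balancedWeight, Finset.expect_sub_distrib, shiftDensity,
    Finset.expect_mul_expect, ← Finset.mul_expect]

theorem boxMean_setInd_le (hA : A ⊆ E₁ ×ˢ E₂) (B : Finset ℤ) (t₁ t₂ : ℤ) :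
    boxMean (fun x y => setInd A (x, y)) B t₁ t₂
      ≤ shiftDensity E₁ B t₁ * shiftDensity E₂ B t₂ := by
  simp only [boxMean, shiftDensity, Finset.expect_mul_expect]
  exact Finset.expect_le_expect fun x _ => Finset.expect_le_expect fun y _ => setInd_le_mul hA _ _

end Weight

/-! ### The energy increment -/

theorem almostInvariant_of_isRegular {Λ : BohrDatum} (hreg : Λ.IsRegular) {k h : ℝ} (hk0 : 0 < k)
    (hk1 : k < 1) (hh : h * (200 * (Λ.dim : ℝ)) < k) {n : ℤ} (hn : |(n : ℝ)| ≤ h * Λ.length)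
    (hθ : ∀ j, ‖n • Λ.freq j‖ ≤ h * Λ.radius) : AlmostInvariant k Λ.carrier n := by
  have hd : (0 : ℝ) < Λ.dim := by exact_mod_cast Λ.dim_pos
  have := almostInvariant_of_isRegularAt (h := h) (hreg (k / 2) (by linarith) (by linarith))
    (by rw [lt_div_iff₀ (by positivity)]; linarith) hn hθ
  rwa [mul_div_cancel₀ _ two_ne_zero] at this

theorem refinementSystem_of_isFineAttendant {Λ Λ' : BohrDatum} (hreg : Λ.IsRegular) {ε k : ℝ}
    (hε : 0 < ε) (hε1 : ε ≤ 1) (hk1 : k < 1) (hk : 1000 * (Λ.dim : ℝ) * ε ^ 2 ≤ k)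
    (hΛ' : IsFineAttendant ε Λ Λ') (R : ℤ → BohrDatum)
    (hR : ∀ m, ∀ n ∈ (R m).carrier, |(n : ℝ)| ≤ ε ^ 4 * Λ.length ∧
      ∀ j, ‖n • Λ.freq j‖ ≤ ε ^ 4 * Λ.radius) :
    RefinementSystem k Λ.carrier Λ'.carrier (fun m => (R m).carrier) := by
  have hd : (1 : ℝ) ≤ Λ.dim := by exact_mod_cast Λ.dim_pos
  have hε2 : 0 < ε ^ 2 := by positivity
  have hdε : ε ^ 2 ≤ Λ.dim * ε ^ 2 := by nlinarith
  have hk0 : 0 < k := by nlinarith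
  have hε4 : ε ^ 4 ≤ 4 * ε ^ 2 := by
    have : ε ^ 2 ≤ 1 := pow_le_one₀ hε.le hε1
    nlinarith
  have hbase : 4 * ε ^ 2 * (200 * (Λ.dim : ℝ)) < k := by nlinarith
  have hmid : ε ^ 2 * (200 * (Λ'.dim : ℝ)) < k := by
    rw [hΛ'.dim_eq]; push_cast; nlinarith
  refine ⟨Λ.carrier_nonempty, Λ'.carrier_nonempty, fun m => (R m).carrier_nonempty,
    fun n hn => ?_, fun m l hl => ?_, fun m l hl => ?_⟩
  · have := hΛ'.small n hn
    exact almostInvariant_of_isRegular hreg hk0 hk1 hbase this.1 this.2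
  · have := hR m l hl
    exact almostInvariant_of_isRegular hreg hk0 hk1 hbase
      (this.1.trans (mul_le_mul_of_nonneg_right hε4 Λ.length_pos.le))
      (fun j => (this.2 j).trans (mul_le_mul_of_nonneg_right hε4 Λ.radius_pos.le))
  · have h1 := hR m l hl
    have := hΛ'.small_of_small l h1.1 h1.2
    exact almostInvariant_of_isRegular hΛ'.attendant.1 hk0 hk1 hmid this.1 this.2

/-- If `E₁` fails to be uniform on `Λ + t₁`, then some box belonging to a refinement of `Λ` has a
combination `μ · mean + energy` that is larger by `σ³ / 16`, up to a loss of `3 k` in the mean.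
The box is found by averaging, and which one it is depends on `μ`. -/
theorem exists_refinement_of_not_uniform {Λ Λ' : BohrDatum} (hreg : Λ.IsRegular)
    (hrad : Λ.radius ≤ 1) {ε k σ : ℝ} (hε : 0 < ε) (hε1 : ε ≤ 1)
    (hk : 1000 * (Λ.dim : ℝ) * ε ^ 2 ≤ k) (hσ0 : 0 < σ) (hσ1 : σ ≤ 1) (hkσ : k ≤ σ ^ 3 / 1024)
    (hΛ' : IsFineAttendant ε Λ Λ') {E₁ E₂ : Finset ℤ} {t₁ t₂ : ℤ}
    (hnot : ¬ IsUniformSubset σ ε Λ Λ' (shiftSet E₁ (-t₁) ∩ Λ.carrier)) {w : ℤ → ℤ → ℝ}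
    (hw : ∀ x y, |w x y| ≤ 1) {μ : ℝ} (hμ : 0 ≤ μ) :
    ∃ (Λ₁ : BohrDatum) (t₁' t₂' : ℤ), IsRefinement ε Λ Λ₁ ∧
      μ * (boxMean w Λ.carrier t₁ t₂ - 3 * k) + shiftDensity E₁ Λ.carrier t₁ ^ 2
          + shiftDensity E₂ Λ.carrier t₂ ^ 2 + σ ^ 3 / 16
        ≤ μ * boxMean w Λ₁.carrier t₁' t₂' + shiftDensity E₁ Λ₁.carrier t₁' ^ 2
          + shiftDensity E₂ Λ₁.carrier t₂' ^ 2 := by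
  classical
  have hd : (1 : ℝ) ≤ Λ.dim := by exact_mod_cast Λ.dim_pos
  have hε2 : 0 < ε ^ 2 := by positivity
  have hε21 : ε ^ 2 ≤ 1 := pow_le_one₀ hε.le hε1
  have hdε : ε ^ 2 ≤ Λ.dim * ε ^ 2 := by nlinarith
  have hk0 : 0 < k := by nlinarith
  have hσ3 : σ ^ 3 ≤ σ := by
    have : σ ^ 2 ≤ 1 := pow_le_one₀ hσ0.le hσ1
    nlinarith
  have hσ2 : σ ^ 3 ≤ σ ^ 2 := by nlinarith [sq_nonneg σ]
  have hk1 : k < 1 := by linarith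
  choose R hRref hR using fun x => exists_isRefinement Λ x hε
  have hsys : ∀ X : ℤ → UnitAddCircle,
      RefinementSystem k Λ.carrier Λ'.carrier (fun m => (R (X m)).carrier) := fun X =>
    refinementSystem_of_isFineAttendant hreg hε hε1 hk1 hk hΛ' _
      fun m n hn => ⟨(hR _ n hn).1, (hR _ n hn).2.1⟩
  have hchar : ∀ x, ∀ l ∈ (R x).carrier, 2 * Real.pi * ‖l • x‖ ≤ k := by
    intro x l hl
    have h1 := (hR x l hl).2.2
    have h2 : ε ^ 4 * Λ.radius ≤ ε ^ 2 := by
      calc ε ^ 4 * Λ.radius ≤ ε ^ 4 * 1 := mul_le_mul_of_nonneg_left hrad (by positivity)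
        _ = ε ^ 2 * ε ^ 2 := by ring
        _ ≤ ε ^ 2 := mul_le_of_le_one_right hε2.le hε21
    have h3 := Real.pi_lt_four
    have h4 := Real.pi_pos
    have h5 := norm_nonneg (l • x)
    nlinarith
  set δ := shiftDensity E₁ Λ.carrier t₁ with hδdef
  set Q := shiftSet E₁ (-t₁) ∩ Λ.carrier with hQdef
  set u : ℤ → ℝ := fun x => setInd E₁ (t₁ + x) with hu
  have hu01 : ∀ s, 0 ≤ u s ∧ u s ≤ 1 := fun s => setInd_mem_Icc _ _
  have hδ01 := shiftDensity_mem_Icc (E := E₁) Λ.carrier_nonempty t₁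
  have hQu : ∀ s ∈ Λ.carrier, u s = if s ∈ Q then 1 else 0 := fun s hs => by
    simp [hu, setInd, hQdef, mem_shiftSet_neg, hs]
  have hQB : Q ⊆ Λ.carrier := Finset.inter_subset_right
  have hrel : relDensity Λ.carrier Q = δ := relDensity_shiftSet_inter _ _ _
  have hBpos : (0 : ℝ) < Λ.carrier.card := by exact_mod_cast Λ.carrier_nonempty.card_pos
  have hSpos : (0 : ℝ) < Λ'.carrier.card := by exact_mod_cast Λ'.carrier_nonempty.card_pos
  have key : ∀ X : ℤ → UnitAddCircle,
      σ ^ 3 / 16 + 6 * k ≤ RefinementSystem.deviation Λ.carrier Λ'.carrier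
        (fun m => (R (X m)).carrier) u δ →
      ∃ (Λ₁ : BohrDatum) (t₁' t₂' : ℤ), IsRefinement ε Λ Λ₁ ∧
      μ * (boxMean w Λ.carrier t₁ t₂ - 3 * k) + shiftDensity E₁ Λ.carrier t₁ ^ 2
          + shiftDensity E₂ Λ.carrier t₂ ^ 2 + σ ^ 3 / 16
        ≤ μ * boxMean w Λ₁.carrier t₁' t₂' + shiftDensity E₁ Λ₁.carrier t₁' ^ 2
          + shiftDensity E₂ Λ₁.carrier t₂' ^ 2 := by
    intro X hX
    obtain ⟨m, -, n, -, j, -, h⟩ := (hsys X).exists_le (w := fun x y => w (t₁ + x) (t₂ + y))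
      (fun x y => hw _ _) (u₁ := u) hu01 (u₂ := fun y => setInd E₂ (t₂ + y))
      (fun s => setInd_mem_Icc _ _) hμ
    refine ⟨R (X m), t₁ + m + n, t₂ + j, hRref _, ?_⟩
    have e : 𝔼 x ∈ Λ.carrier, u x = δ := rfl
    rw [e] at h
    simp only [boxMean, shiftDensity, hu, add_assoc] at h hX ⊢
    have e' : 𝔼 x ∈ Λ.carrier, setInd E₁ (t₁ + x) = δ := rfl
    rw [e']
    linarith
  by_contra hcon
  refine hnot ⟨hΛ'.attendant, hQB, ?_, ?_, ?_⟩ <;> rw [hrel] <;> by_contra! hfail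
  · -- each bad shift `m` comes with a frequency of its own; passing to `σ / 2` avoids the question
    -- whether the supremum is attained
    have hx : ∀ m, ∃ x, m ∈ badShifts σ δ Λ.carrier Λ'.carrier Q →
        σ / 2 * Λ'.carrier.card < ‖fourierTransform (fun s => charFn (Q ∩ shiftSet Λ'.carrier m) s
          - (δ : ℂ) * charFn (shiftSet Λ'.carrier m) s) x‖ := by
      intro m
      by_cases hm : m ∈ badShifts σ δ Λ.carrier Λ'.carrier Q
      · have h1 := (Finset.mem_filter.1 hm).2
        obtain ⟨x, hx⟩ := exists_lt_norm_fourierTransform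
          (lt_of_lt_of_le (by nlinarith : σ / 2 * (Λ'.carrier.card : ℝ) < σ * Λ'.carrier.card) h1)
        exact ⟨x, fun _ => hx⟩
      · exact ⟨0, fun h => absurd h hm⟩
    choose X hX using hx
    refine hcon (key X ?_)
    have h1 := (hsys X).le_deviation_of_local_fourier hu01 hQu hQB hδ01
      (χ := fun m n => fourier (-(m + n)) (X m)) (fun m n => norm_fourier_eq_one _ _)
      (fun m l hl n => by
        show ‖(fourier (-(m + (n + l))) (X m) : ℂ) - fourier (-(m + n)) (X m)‖ ≤ k
        rw [← add_assoc]
        exact (norm_fourier_neg_add_sub_le _ _ _).trans (hchar _ l hl))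
      hσ1 hk0.le (by linarith) (Z := badShifts σ δ Λ.carrier Λ'.carrier Q)
      (Finset.filter_subset _ _) hfail.le (fun m hm => by
        have h2 := hX m hm
        rw [fourierTransform_balanced] at h2
        rw [Finset.expect_eq_sum_div_card, norm_div, Complex.norm_natCast, le_div_iff₀ hSpos]
        exact h2.le)
    have h2 : (σ / 2 - 2 * k) ^ 2 ≥ (σ * (31 / 64)) ^ 2 :=
      pow_le_pow_left₀ (by positivity) (by linarith) 2
    have h3 : σ * (σ / 2 - 2 * k) ^ 2 ≥ σ * (σ * (31 / 64)) ^ 2 :=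
      mul_le_mul_of_nonneg_left h2 hσ0.le
    have h4 : σ * (σ * (31 / 64)) ^ 2 = 961 / 4096 * σ ^ 3 := by ring
    linarith
  · refine hcon (key (fun _ => 0) ?_)
    have h1 := (hsys fun _ => 0).le_deviation_of_local_density hu01 hQu hQB hδ01 (σ := σ) (by
      rw [one_div, inv_mul_eq_div] at hfail
      rw [Finset.expect_eq_sum_div_card]
      simpa only [relDensity_shiftSet] using hfail.le)
    linarith
  · obtain ⟨x, hx⟩ := exists_lt_norm_fourierTransform hfail
    refine hcon (key (fun _ => x) ?_)
    have h1 := fourierTransform_balanced Q Λ.carrier 0 δ x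
    rw [shiftSet_zero] at h1
    rw [h1] at hx
    have h2 := (hsys fun _ => x).le_deviation_of_global_fourier hu01 hδ01
      (χ := fun n => fourier (-n) x) (fun n => norm_fourier_eq_one _ _)
      (fun l hl n => (norm_fourier_neg_add_sub_le _ _ _).trans (hchar _ l hl)) (σ := σ)
      (by linarith) (by
        rw [Finset.expect_eq_sum_div_card, norm_div, Complex.norm_natCast, le_div_iff₀ hBpos]
        refine hx.le.trans_eq (congrArg _ (Finset.sum_congr rfl fun s hs => ?_))
        rw [zero_add, hQu s hs])
    have h3 : (σ * (1 / 2)) ^ 2 ≤ (σ - 3 * k) ^ 2 :=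
      pow_le_pow_left₀ (by positivity) (by linarith) 2
    have h4 : (σ * (1 / 2)) ^ 2 = σ ^ 2 / 4 := by ring
    linarith

/-! ### Iteration -/

/-- The lower bounds for the radius and the length of a Bohr set that depend on its dimension. -/
structure ScaleBound (ε r N : ℝ) (Λ : BohrDatum) : Prop where
  radius_le_one : Λ.radius ≤ 1
  le_radius : ((2 : ℝ) ^ (-10 : ℤ) * ε) ^ Λ.dim * r ≤ Λ.radius
  le_length : ((2 : ℝ) ^ (-10 : ℤ) * ε) ^ Λ.dim * N ≤ Λ.length

theorem ScaleBound.refinement {ε r N : ℝ} {Λ Λ' : BohrDatum} (h : ScaleBound ε r N Λ) (hε : 0 < ε)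
    (hε1 : ε ≤ 1) (h' : IsRefinement ε Λ Λ') : ScaleBound ε r N Λ' := by
  have hε4 : 0 < ε ^ 4 := by positivity
  have hε41 : ε ^ 4 ≤ 1 := pow_le_one₀ hε.le hε1
  have key : ∀ a b c : ℝ, 0 < b → ((2 : ℝ) ^ (-10 : ℤ) * ε) ^ Λ.dim * a ≤ b → ε ^ 4 * b / 2 ≤ c →
      ((2 : ℝ) ^ (-10 : ℤ) * ε) ^ (Λ.dim + 4) * a ≤ c := by
    intro a b c hb hab hbc
    have e : ((2 : ℝ) ^ (-10 : ℤ) * ε) ^ (Λ.dim + 4) * a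
        = (2 ^ (-40 : ℤ) * ε ^ 4) * (((2 : ℝ) ^ (-10 : ℤ) * ε) ^ Λ.dim * a) := by
      rw [pow_add]; norm_num; ring
    rw [e]
    refine (mul_le_mul_of_nonneg_left hab (by positivity)).trans (le_trans ?_ hbc)
    have : (2 : ℝ) ^ (-40 : ℤ) ≤ 1 / 2 := by norm_num
    nlinarith [mul_pos hε4 hb]
  refine ⟨?_, ?_, ?_⟩
  · exact h'.radius.2.trans (mul_le_one₀ hε41 Λ.radius_pos.le h.radius_le_one)
  · rw [h'.dim_eq]; exact key _ _ _ Λ.radius_pos h.le_radius h'.radius.1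
  · rw [h'.dim_eq]; exact key _ _ _ Λ.length_pos h.le_length h'.length.1

/-- If on every box where the mean of `w` exceeds `c` one of the two sets fails to be uniform, then
the mean of `w` is small wherever `n` refinements can still be made. Each of them gains
`σ³ / 16` in energy, and the energy is at most `2`; the weight `n σ³ / 16` of the mean in the
induction is chosen such that a gain in energy always pays for the bound `1` of the mean. -/
theorem mul_boxMean_le {E₁ E₂ : Finset ℤ} {w : ℤ → ℤ → ℝ} (hw : ∀ x y, |w x y| ≤ 1)
    {ε k σ c r N : ℝ} {D : ℕ} (hε : 0 < ε) (hε1 : ε ≤ 1 / 2) (hk : 1000 * (D : ℝ) * ε ^ 2 ≤ k)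
    (hσ0 : 0 < σ) (hσ1 : σ ≤ 1) (hkσ : k ≤ σ ^ 3 / 1024) (hc : 0 ≤ c)
    (H : ∀ (Λ : BohrDatum) (t₁ t₂ : ℤ), Λ.IsRegular → Λ.dim ≤ D → ScaleBound ε r N Λ →
      c < boxMean w Λ.carrier t₁ t₂ → ∀ Λ', IsFineAttendant ε Λ Λ' →
      ¬ (IsUniformSubset σ ε Λ Λ' (shiftSet E₁ (-t₁) ∩ Λ.carrier) ∧
        IsUniformSubset σ ε Λ Λ' (shiftSet E₂ (-t₂) ∩ Λ.carrier)))
    (n : ℕ) (Λ : BohrDatum) (t₁ t₂ : ℤ) (hreg : Λ.IsRegular) (hdim : Λ.dim + 4 * n ≤ D)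
    (hscale : ScaleBound ε r N Λ) :
    n * (σ ^ 3 / 16) * (boxMean w Λ.carrier t₁ t₂ - c - 3 * k * n)
      ≤ 2 - shiftDensity E₁ Λ.carrier t₁ ^ 2 - shiftDensity E₂ Λ.carrier t₂ ^ 2 := by
  have hk0 : 0 ≤ k := le_trans (by positivity) hk
  induction n generalizing Λ t₁ t₂ with
  | zero =>
    have h1 := shiftDensity_mem_Icc (E := E₁) Λ.carrier_nonempty t₁
    have h2 := shiftDensity_mem_Icc (E := E₂) Λ.carrier_nonempty t₂
    simp only [Nat.cast_zero, zero_mul]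
    nlinarith
  | succ n ih =>
    have h1 := shiftDensity_mem_Icc (E := E₁) Λ.carrier_nonempty t₁
    have h2 := shiftDensity_mem_Icc (E := E₂) Λ.carrier_nonempty t₂
    have hη : 0 < σ ^ 3 / 16 := by positivity
    set g := boxMean w Λ.carrier t₁ t₂ with hg
    have hg1 : g ≤ 1 := Finset.expect_le Λ.carrier_nonempty fun x _ =>
      Finset.expect_le Λ.carrier_nonempty fun y _ => (abs_le.1 (hw _ _)).2
    by_cases hle : g - c - 3 * k * ((n + 1 : ℕ) : ℝ) ≤ 0
    · have : ((n + 1 : ℕ) : ℝ) * (σ ^ 3 / 16) * (g - c - 3 * k * ((n + 1 : ℕ) : ℝ)) ≤ 0 :=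
        mul_nonpos_of_nonneg_of_nonpos (by positivity) hle
      nlinarith
    push Not at hle
    have hcg : c < g := by
      have : 0 ≤ 3 * k * ((n + 1 : ℕ) : ℝ) := by positivity
      linarith
    obtain ⟨Λ', hΛ'⟩ := exists_isFineAttendant Λ hscale.radius_le_one hε hε1
    have hdimD : Λ.dim ≤ D := by omega
    have hkΛ : 1000 * (Λ.dim : ℝ) * ε ^ 2 ≤ k := by
      refine le_trans ?_ hk
      have : (Λ.dim : ℝ) ≤ D := by exact_mod_cast hdimD
      gcongr
    have hμ : (0 : ℝ) ≤ n * (σ ^ 3 / 16) := by positivity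
    have hstep : ∃ (Λ₁ : BohrDatum) (t₁' t₂' : ℤ), IsRefinement ε Λ Λ₁ ∧
        n * (σ ^ 3 / 16) * (g - 3 * k) + shiftDensity E₁ Λ.carrier t₁ ^ 2
            + shiftDensity E₂ Λ.carrier t₂ ^ 2 + σ ^ 3 / 16
          ≤ n * (σ ^ 3 / 16) * boxMean w Λ₁.carrier t₁' t₂' + shiftDensity E₁ Λ₁.carrier t₁' ^ 2
            + shiftDensity E₂ Λ₁.carrier t₂' ^ 2 := by
      rcases not_and_or.1 (H Λ t₁ t₂ hreg hdimD hscale hcg Λ' hΛ') with hnot | hnot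
      · exact exists_refinement_of_not_uniform hreg hscale.radius_le_one hε (by linarith) hkΛ hσ0
          hσ1 hkσ hΛ' hnot hw hμ
      · obtain ⟨Λ₁, t₂', t₁', hR, h⟩ := exists_refinement_of_not_uniform (E₂ := E₁) (t₂ := t₁) hreg
          hscale.radius_le_one hε (by linarith) hkΛ hσ0 hσ1 hkσ hΛ' hnot (fun x y => hw y x) hμ
        rw [boxMean_swap w, boxMean_swap w] at h
        exact ⟨Λ₁, t₁', t₂', hR, by linarith⟩
    obtain ⟨Λ₁, t₁', t₂', hR, h⟩ := hstep
    have h3 := ih Λ₁ t₁' t₂' hR.regular (by rw [hR.dim_eq]; omega)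
      (hscale.refinement hε (by linarith) hR)
    -- raising the weight of the mean by `σ³ / 16` costs at most `σ³ / 16`, the gain in energy
    have h4 : σ ^ 3 / 16 * (g - c - 3 * k * ((n + 1 : ℕ) : ℝ)) ≤ σ ^ 3 / 16 * 1 :=
      mul_le_mul_of_nonneg_left (by
        have : 0 ≤ 3 * k * ((n + 1 : ℕ) : ℝ) := by positivity
        linarith) hη.le
    push_cast at h4 ⊢
    linarith

/-- If the elements of `T` hardly move `B`, the mean of `w` over a box of `B` is almost attained on
a box of `T`. -/
theorem exists_boxMean_ge {κ : ℝ} {B T : Finset ℤ} (hB : B.Nonempty) (hT : T.Nonempty)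
    (h : ∀ l ∈ T, AlmostInvariant κ B l) {w : ℤ → ℤ → ℝ} (hw : ∀ x y, |w x y| ≤ 1) (s₁ s₂ : ℤ) :
    ∃ t₁ t₂, boxMean w B s₁ s₂ - 2 * κ ≤ boxMean w T t₁ t₂ := by
  have h1 : |(𝔼 m ∈ B, 𝔼 l ∈ T, 𝔼 k ∈ B, 𝔼 l' ∈ T, w (s₁ + (m + l)) (s₂ + (k + l')))
      - 𝔼 m ∈ B, 𝔼 l ∈ T, 𝔼 k ∈ B, w (s₁ + (m + l)) (s₂ + k)| ≤ κ :=
    abs_expect_sub_expect_le hB fun m _ => abs_expect_sub_expect_le hT fun l _ =>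
      abs_expect_expect_add_sub_le hT h (w := fun y => w (s₁ + (m + l)) (s₂ + y)) fun y => hw _ _
  have h2 := abs_expect_expect_add_sub_le hT h (w := fun x => 𝔼 k ∈ B, w (s₁ + x) (s₂ + k))
    fun x => (Finset.abs_expect_le _ _).trans (Finset.expect_le hB fun k _ => hw _ _)
  have h3 : boxMean w B s₁ s₂ - 2 * κ
      ≤ 𝔼 m ∈ B, 𝔼 k ∈ B, 𝔼 l ∈ T, 𝔼 l' ∈ T, w (s₁ + (m + l)) (s₂ + (k + l')) := by
    have e : 𝔼 m ∈ B, 𝔼 k ∈ B, 𝔼 l ∈ T, 𝔼 l' ∈ T, w (s₁ + (m + l)) (s₂ + (k + l'))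
        = 𝔼 m ∈ B, 𝔼 l ∈ T, 𝔼 k ∈ B, 𝔼 l' ∈ T, w (s₁ + (m + l)) (s₂ + (k + l')) :=
      Finset.expect_congr rfl fun m _ => Finset.expect_comm _ _ _
    rw [e, boxMean]
    linarith [(abs_le.1 h1).1, (abs_le.1 h2).1]
  obtain ⟨m, -, hm⟩ := Finset.exists_le_of_le_expect hB h3
  obtain ⟨k, -, hk⟩ := Finset.exists_le_of_le_expect hB hm
  refine ⟨s₁ + m, s₂ + k, hk.trans_eq ?_⟩
  simp only [boxMean, add_assoc]

/-- A box on which the balanced weight has mean larger than `c ≥ 0` carries a large part of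
`E₁ × E₂`, on which `A` has relative density at least `γ`. -/
theorem mass_and_density_of_lt_boxMean {A : Finset (ℤ × ℤ)} {E₁ E₂ : Finset ℤ}
    (hA : A ⊆ E₁ ×ˢ E₂) {γ c : ℝ} (hγ : 0 ≤ γ) (hc : 0 ≤ c) (B : Finset ℤ) (t₁ t₂ : ℤ)
    (h : c < boxMean (balancedWeight A E₁ E₂ γ) B t₁ t₂) :
    c * (B.card : ℝ) ^ 2
        ≤ (((shiftSet E₁ (-t₁) ∩ B) ×ˢ (shiftSet E₂ (-t₂) ∩ B)).card : ℝ) ∧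
      γ ≤ relDensity ((shiftSet E₁ (-t₁) ∩ B) ×ˢ (shiftSet E₂ (-t₂) ∩ B))
        (shiftPairs A (-t₁) (-t₂)) := by
  rw [boxMean_balancedWeight] at h
  have h1 := boxMean_setInd_le hA B t₁ t₂
  set a := boxMean (fun x y => setInd A (x, y)) B t₁ t₂ with ha
  set b := shiftDensity E₁ B t₁ * shiftDensity E₂ B t₂ with hb
  have hb0 : 0 ≤ b := mul_nonneg (Finset.expect_nonneg fun _ _ => (setInd_mem_Icc _ _).1)
    (Finset.expect_nonneg fun _ _ => (setInd_mem_Icc _ _).1)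
  have hcb : c < b := by nlinarith
  have hcard : (((shiftSet E₁ (-t₁) ∩ B) ×ˢ (shiftSet E₂ (-t₂) ∩ B)).card : ℝ)
      = (B.card : ℝ) ^ 2 * b := by
    rw [Finset.card_product, Nat.cast_mul, card_shiftSet_inter, card_shiftSet_inter, hb]; ring
  have hB : B.Nonempty := by
    by_contra hB
    rw [Finset.not_nonempty_iff_eq_empty] at hB
    simp [hb, hB, shiftDensity] at hcb
    linarith
  have hBpos : (0 : ℝ) < B.card := by exact_mod_cast hB.card_pos
  constructor
  · rw [hcard]; nlinarith [pow_pos hBpos 2]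
  · rw [relDensity, card_shiftPairs_inter hA, hcard, ← ha,
      le_div_iff₀ (mul_pos (pow_pos hBpos 2) (hc.trans_lt hcb))]
    nlinarith [pow_pos hBpos 2]

theorem boxMean_balancedWeight_of_subset {A : Finset (ℤ × ℤ)} {E₁ E₂ B : Finset ℤ} {s₁ s₂ : ℤ}
    (hA : A ⊆ E₁ ×ˢ E₂) (hE₁ : E₁ ⊆ shiftSet B s₁) (hE₂ : E₂ ⊆ shiftSet B s₂)
    (hB : B.Nonempty) {β₁ β₂ ρ γ : ℝ} (hβ₁ : (E₁.card : ℝ) = β₁ * B.card)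
    (hβ₂ : (E₂.card : ℝ) = β₂ * B.card) (hρ : (A.card : ℝ) = ρ * (E₁.card * E₂.card)) :
    boxMean (balancedWeight A E₁ E₂ γ) B s₁ s₂ = (ρ - γ) * (β₁ * β₂) := by
  have hBpos : (0 : ℝ) < B.card := by exact_mod_cast hB.card_pos
  have hshift : ∀ {E : Finset ℤ} {s : ℤ}, E ⊆ shiftSet B s →
      shiftSet E (-s) ∩ B = shiftSet E (-s) := by
    intro E s hE
    refine Finset.inter_eq_left.2 fun x hx => ?_
    have h1 := hE (mem_shiftSet_neg.1 hx)
    obtain ⟨y, hy, h2⟩ := Finset.mem_image.1 h1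
    have : y = x := by linarith
    rwa [← this]
  have hden : ∀ {E : Finset ℤ} {s : ℤ} {β : ℝ}, E ⊆ shiftSet B s → (E.card : ℝ) = β * B.card →
      shiftDensity E B s = β := by
    intro E s β hE hβ
    have h1 := card_shiftSet_inter E B s
    rw [hshift hE, card_shiftSet, hβ, mul_comm] at h1
    exact (mul_left_cancel₀ hBpos.ne' h1).symm
  have h1 := card_shiftPairs_inter hA B s₁ s₂
  have h2 : shiftPairs A (-s₁) (-s₂) ∩ ((shiftSet E₁ (-s₁) ∩ B) ×ˢ (shiftSet E₂ (-s₂) ∩ B))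
      = shiftPairs A (-s₁) (-s₂) := by
    rw [hshift hE₁, hshift hE₂]
    refine Finset.inter_eq_left.2 ?_
    rintro ⟨x, y⟩ hxy
    have := Finset.mem_product.1 (hA (mem_shiftPairs_neg.1 hxy))
    exact Finset.mem_product.2 ⟨mem_shiftSet_neg.2 this.1, mem_shiftSet_neg.2 this.2⟩
  have h3 : (shiftPairs A (-s₁) (-s₂)).card = A.card :=
    Finset.card_image_of_injective _ fun p q hpq => by
      simpa [Prod.ext_iff] using hpq
  rw [h2, h3, hρ, hβ₁, hβ₂] at h1
  have h4 : boxMean (fun x y => setInd A (x, y)) B s₁ s₂ = ρ * (β₁ * β₂) :=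
    (mul_left_cancel₀ (pow_pos hBpos 2).ne' (by rw [← h1]; ring)).symm
  rw [boxMean_balancedWeight, hden hE₁ hβ₁, hden hE₂ hβ₂, h4]
  ring

/-- The numerical constraints: `K` refinements, each adding four dimensions, exhaust the energy, and
their errors and dimensions stay within the allowed bounds. -/
theorem exists_number_of_refinements {ω σ ε κ : ℝ} {d : ℕ} (hω0 : 0 < ω) (hω1 : ω ≤ 1) (hσ0 : 0 < σ)
    (hσ1 : σ ≤ 1) (hε0 : 0 < ε) (hd : (1 : ℝ) ≤ d)
    (hκ : κ = (2 : ℝ) ^ (-100 : ℤ) * ω ^ 5 * σ ^ 3) (hεκ : ε ≤ κ / (100 * (d : ℝ))) :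
    ∃ K : ℕ, 64 ≤ K * (σ ^ 3 * ω) ∧ 1000 * ((d + 4 + 4 * K : ℕ) : ℝ) * ε ^ 2 ≤ 2 * κ ∧
      ((d + 4 + 4 * K : ℕ) : ℝ) ≤ (2 : ℝ) ^ 30 * ω ^ (-5 : ℤ) * σ ^ (-3 : ℤ) + d ∧
      0 < κ ∧ K * κ ≤ ω / 1000 ∧ κ ≤ ω / 1000 ∧ 2 * κ ≤ σ ^ 3 / 1024 ∧ ε ≤ 1 / 2 := by
  -- a name for `2⁻¹⁰⁰`, so that the tactics below do not expand it
  obtain ⟨c, hc⟩ : ∃ c, c = (2 : ℝ) ^ (-100 : ℤ) := ⟨_, rfl⟩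
  rw [← hc] at hκ
  have hc0 : 0 < c := by rw [hc]; positivity
  have hpow : c ≤ 1 / 10 ^ 20 := by rw [hc]; norm_num
  set q := σ ^ 3 * ω with hq
  have hσ3 : 0 < σ ^ 3 := by positivity
  have hσ31 : σ ^ 3 ≤ 1 := pow_le_one₀ hσ0.le hσ1
  have hq0 : 0 < q := by positivity
  have hq1 : q ≤ 1 := mul_le_one₀ hσ31 hω0.le hω1
  have hκq : κ = c * ω ^ 4 * q := by rw [hκ, hq]; ring
  have hω41 : ω ^ 4 ≤ 1 := pow_le_one₀ hω0.le hω1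
  have hω3 : ω ^ 4 ≤ ω := by
    have : ω ^ 3 ≤ 1 := pow_le_one₀ hω0.le hω1
    nlinarith
  have hκ0 : 0 < κ := by rw [hκq]; positivity
  have hκle : κ ≤ c * ω * q := by
    rw [hκq]; gcongr
  have hκσ : κ ≤ c * σ ^ 3 := by
    refine hκle.trans ?_
    rw [mul_assoc]
    refine mul_le_mul_of_nonneg_left ?_ (by positivity)
    have h1 : ω * q ≤ q := mul_le_of_le_one_left hq0.le hω1
    have h2 : q ≤ σ ^ 3 := mul_le_of_le_one_right hσ3.le hω1
    linarith
  have hκω : κ ≤ c * ω := by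
    refine hκle.trans (mul_le_of_le_one_right (by positivity) hq1)
  have hεd : ε * d ≤ κ / 100 := by
    rw [le_div_iff₀ (by positivity)] at hεκ; linarith
  have hεκ' : ε ≤ κ / 100 := by nlinarith
  have hκ1 : κ ≤ c := hκω.trans (mul_le_of_le_one_right (by positivity) hω1)
  have hε1 : ε ≤ 1 / 10 ^ 20 := by linarith
  have hε2 : ε ≤ 1 / 2 := by norm_num at hε1 ⊢; linarith
  set K : ℕ := ⌈64 / q⌉₊ with hK
  have hKge : 64 ≤ K * q := by
    have := Nat.le_ceil (64 / q)
    rwa [div_le_iff₀ hq0] at this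
  have hKle : K * q ≤ 65 := by
    have := (Nat.ceil_lt_add_one (by positivity : 0 ≤ 64 / q)).le
    have h2 : (64 / q + 1) * q = 64 + q := by field_simp
    have := mul_le_mul_of_nonneg_right this hq0.le
    linarith
  have hKκ : K * κ ≤ c * 65 * ω := by
    calc K * κ ≤ K * (c * ω * q) := by gcongr
      _ = c * ω * (K * q) := by ring
      _ ≤ c * ω * 65 := by gcongr
      _ = _ := by ring
  set D : ℕ := d + 4 + 4 * K with hD
  have hDcast : (D : ℝ) = d + 4 + 4 * K := by rw [hD]; push_cast; ring
  have hDε : D * ε ≤ 1 / 1000 := by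
    have h1 : K * ε ≤ K * κ := by gcongr; linarith
    have h2 : c * 65 * ω ≤ 1 / 10 ^ 20 * 65 * 1 := by gcongr
    have h3 : D * ε = ε * d + 4 * ε + 4 * (K * ε) := by rw [hDcast]; ring
    linarith
  have hDk : 1000 * (D : ℝ) * ε ^ 2 ≤ 2 * κ := by
    have h1 := mul_le_mul_of_nonneg_right hDε (by positivity : 0 ≤ 1000 * ε)
    have h2 : 1000 * (D : ℝ) * ε ^ 2 = D * ε * (1000 * ε) := by ring
    linarith
  have hDle : (D : ℝ) ≤ (2 : ℝ) ^ 30 * ω ^ (-5 : ℤ) * σ ^ (-3 : ℤ) + d := by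
    have e : ω ^ (-5 : ℤ) * σ ^ (-3 : ℤ) = 1 / (ω ^ 4 * q) := by
      rw [zpow_neg, zpow_neg, hq]
      norm_cast
      field_simp
    have h1 : (K : ℝ) ≤ 65 / q := by rwa [le_div_iff₀ hq0]
    have h2 : 1 ≤ 1 / q := by rwa [le_div_iff₀ hq0, one_mul]
    have h3 : 1 / q ≤ 1 / (ω ^ 4 * q) :=
      one_div_le_one_div_of_le (by positivity) (mul_le_of_le_one_left hq0.le hω41)
    have h4 : 65 / q = 65 * (1 / q) := by ring
    rw [mul_assoc, e, hDcast]
    norm_num at h1 h2 h3 h4 ⊢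
    linarith
  refine ⟨K, hKge, hDk, hDle, hκ0, ?_, ?_, ?_, hε2⟩
  · have : c * 65 * ω ≤ 1 / 10 ^ 20 * 65 * ω := by gcongr
    linarith
  · have : c * ω ≤ 1 / 10 ^ 20 * ω := by gcongr
    linarith
  · have := mul_le_mul_of_nonneg_right hpow hσ3.le
    linarith

theorem proposition5p9
    (Λ : BohrDatum) (s₁ s₂ : ℤ)
    (ε σ τ δ β₁ β₂ κ : ℝ) (E₁ E₂ : Finset ℤ) (A : Finset (ℤ × ℤ))
    (hε : 0 < ε ∧ ε < 1) (hσ : 0 < σ ∧ σ < 1) (hτ : 0 < τ ∧ τ < 1) (hδ : 0 < δ ∧ δ < 1)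
    (hκ : κ = (2 : ℝ) ^ (-100 : ℤ) * (τ * β₁ * β₂) ^ 5 * σ ^ 3)
    (hreg : Λ.IsRegularAt κ) (hrad : Λ.radius ≤ 1)
    (hE₁ : (E₁.card : ℝ) = β₁ * (Λ.carrier.card : ℝ))
    (hE₂ : (E₂.card : ℝ) = β₂ * (Λ.carrier.card : ℝ))
    (hE : E₁ ×ˢ E₂ ⊆ shiftSet Λ.carrier s₁ ×ˢ shiftSet Λ.carrier s₂)
    (hA : A ⊆ E₁ ×ˢ E₂)
    (hdens : relDensity (E₁ ×ˢ E₂) A = δ + τ)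
    (hεκ : ε ≤ κ / (100 * (Λ.dim : ℝ)))
    (hN : ((2 : ℝ) ^ (-100 : ℤ) * Λ.radius * ε) ^
        (-((2 : ℝ) ^ 100 *
          ((τ * β₁ * β₂) ^ (-5 : ℤ) * σ ^ (-3 : ℤ) + (Λ.dim : ℝ)) ^ 2)) ≤ Λ.length)
    (hστ : σ ≤ (2 : ℝ) ^ (-100 : ℤ) * τ * β₁ * β₂) :
    ∃ (Λ' : BohrDatum) (t₁ t₂ : ℤ),
      Λ'.IsRegular ∧
      (Λ'.dim : ℝ) ≤ (2 : ℝ) ^ 30 * (τ * β₁ * β₂) ^ (-5 : ℤ) * σ ^ (-3 : ℤ) + (Λ.dim : ℝ) ∧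
      ((2 : ℝ) ^ (-10 : ℤ) * ε) ^ Λ'.dim * Λ.radius ≤ Λ'.radius ∧
      ((2 : ℝ) ^ (-10 : ℤ) * ε) ^ Λ'.dim * Λ.length ≤ Λ'.length ∧
      ∃ E₁' E₂' : Finset ℤ,
        E₁' = shiftSet E₁ (-t₁) ∩ Λ'.carrier ∧
        E₂' = shiftSet E₂ (-t₂) ∩ Λ'.carrier ∧
        β₁ * β₂ * τ * (Λ'.carrier.card : ℝ) ^ 2 / 16 ≤ ((E₁' ×ˢ E₂').card : ℝ) ∧
        (∃ Λ'' : BohrDatum,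
          IsUniformSubset σ ε Λ' Λ'' E₁' ∧ IsUniformSubset σ ε Λ' Λ'' E₂') ∧
        δ + τ / 16 ≤ relDensity (E₁' ×ˢ E₂') (shiftPairs A (-t₁) (-t₂)) := by
  obtain ⟨hε0, -⟩ := hε
  obtain ⟨hσ0, hσ1⟩ := hσ
  obtain ⟨hτ0, hτ1⟩ := hτ
  obtain ⟨hδ0, -⟩ := hδ
  have hd : (1 : ℝ) ≤ Λ.dim := by exact_mod_cast Λ.dim_pos
  have hΛpos : (0 : ℝ) < Λ.carrier.card := by exact_mod_cast Λ.carrier_nonempty.card_pos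
  -- the set `E₁ × E₂` is nonempty, since otherwise the density of `A` in it would be `0 / 0 = 0`
  have hEne : (E₁ ×ˢ E₂).Nonempty := by
    by_contra h
    rw [Finset.not_nonempty_iff_eq_empty] at h
    rw [h, relDensity] at hdens
    simp at hdens
    linarith
  have hEpos : (0 : ℝ) < (E₁ ×ˢ E₂).card := by exact_mod_cast hEne.card_pos
  obtain ⟨hE₁ne, hE₂ne⟩ := Finset.nonempty_product.1 hEne
  have hsub : E₁ ⊆ shiftSet Λ.carrier s₁ ∧ E₂ ⊆ shiftSet Λ.carrier s₂ := by
    obtain ⟨⟨x, hx⟩, y, hy⟩ := And.intro hE₁ne hE₂ne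
    exact ⟨fun a ha => (Finset.mem_product.1 (hE (Finset.mk_mem_product ha hy))).1,
      fun b hb => (Finset.mem_product.1 (hE (Finset.mk_mem_product hx hb))).2⟩
  have hAcard : (A.card : ℝ) = (δ + τ) * (E₁.card * E₂.card) := by
    rw [relDensity, Finset.inter_eq_left.2 hA, div_eq_iff hEpos.ne'] at hdens
    rw [hdens, Finset.card_product, Nat.cast_mul]
  have hδτ : δ + τ ≤ 1 := by
    rw [← hdens, relDensity]
    exact div_le_one_of_le₀ (by exact_mod_cast Finset.card_le_card Finset.inter_subset_right)
      hEpos.le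
  have hβ : ∀ {E : Finset ℤ} {s : ℤ} {β : ℝ}, E.Nonempty → E ⊆ shiftSet Λ.carrier s →
      (E.card : ℝ) = β * Λ.carrier.card → 0 < β ∧ β ≤ 1 := by
    intro E s β hne hE hβ
    have h1 : (0 : ℝ) < E.card := by exact_mod_cast hne.card_pos
    have h2 : (E.card : ℝ) ≤ Λ.carrier.card := by
      rw [← card_shiftSet Λ.carrier s]
      exact_mod_cast Finset.card_le_card hE
    rw [hβ] at h1 h2
    exact ⟨pos_of_mul_pos_left h1 hΛpos.le, by nlinarith⟩
  obtain ⟨hβ₁0, hβ₁1⟩ := hβ hE₁ne hsub.1 hE₁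
  obtain ⟨hβ₂0, hβ₂1⟩ := hβ hE₂ne hsub.2 hE₂
  set ω := τ * β₁ * β₂ with hω
  have hω0 : 0 < ω := by positivity
  have hω1 : ω ≤ 1 := mul_le_one₀ (mul_le_one₀ hτ1.le hβ₁0.le hβ₁1) hβ₂0.le hβ₂1
  obtain ⟨K, hKge, hDk, hDle, hκ0, hKκ, hκω, hκσ, hε2⟩ :=
    exists_number_of_refinements hω0 hω1 hσ0 hσ1.le hε0 hd hκ hεκ
  set D : ℕ := Λ.dim + 4 + 4 * K with hD
  by_contra hcon
  set γ := δ + τ / 16 with hγ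
  set w := balancedWeight A E₁ E₂ γ with hw
  have hw1 : ∀ x y, |w x y| ≤ 1 := abs_balancedWeight_le (by positivity) (by linarith)
  have H : ∀ (Λ' : BohrDatum) (t₁ t₂ : ℤ), Λ'.IsRegular → Λ'.dim ≤ D →
      ScaleBound ε Λ.radius Λ.length Λ' → ω / 16 < boxMean w Λ'.carrier t₁ t₂ →
      ∀ Λ'', IsFineAttendant ε Λ' Λ'' →
      ¬ (IsUniformSubset σ ε Λ' Λ'' (shiftSet E₁ (-t₁) ∩ Λ'.carrier) ∧
        IsUniformSubset σ ε Λ' Λ'' (shiftSet E₂ (-t₂) ∩ Λ'.carrier)) := by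
    intro Λ' t₁ t₂ hreg' hdim hscale hlt Λ'' _ hunif
    obtain ⟨h1, h2⟩ := mass_and_density_of_lt_boxMean hA (by positivity) (by positivity) _ _ _ hlt
    refine hcon ⟨Λ', t₁, t₂, hreg', ?_, hscale.le_radius, hscale.le_length, _, _, rfl, rfl, ?_,
      ⟨Λ'', hunif⟩, h2⟩
    · exact le_trans (by exact_mod_cast hdim) hDle
    · refine le_trans (le_of_eq ?_) h1
      rw [hω]; ring
  -- the given Bohr set need not be regular, and is first replaced by a refinement of itself
  obtain ⟨Λ₀, href₀, hΛ₀⟩ := exists_isRefinement Λ 0 hε0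
  have hε4 : ε ^ 4 < κ / (100 * (Λ.dim : ℝ)) := by
    refine lt_of_lt_of_le ?_ hεκ
    have : ε ^ 4 = ε * ε ^ 3 := by ring
    have h3 : ε ^ 3 < 1 := pow_lt_one₀ hε0.le (by linarith) (by norm_num)
    rw [this]
    exact mul_lt_of_lt_one_right hε0 h3
  have hinv : ∀ l ∈ Λ₀.carrier, AlmostInvariant (2 * κ) Λ.carrier l := fun l hl =>
    almostInvariant_of_isRegularAt hreg hε4 (hΛ₀ l hl).1 (hΛ₀ l hl).2.1
  obtain ⟨t₁, t₂, ht⟩ := exists_boxMean_ge Λ.carrier_nonempty Λ₀.carrier_nonempty hinv hw1 s₁ s₂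
  rw [hw, boxMean_balancedWeight_of_subset hA hsub.1 hsub.2 Λ.carrier_nonempty hE₁ hE₂ hAcard,
    ← hw] at ht
  have hmean : (δ + τ - γ) * (β₁ * β₂) = 15 / 16 * ω := by rw [hγ, hω]; ring
  rw [hmean] at ht
  have hscale : ScaleBound ε Λ.radius Λ.length Λ := by
    have : ((2 : ℝ) ^ (-10 : ℤ) * ε) ^ Λ.dim ≤ 1 := by
      refine pow_le_one₀ (by positivity) (mul_le_one₀ (by norm_num) hε0.le (by linarith))
    exact ⟨hrad, mul_le_of_le_one_left Λ.radius_pos.le this,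
      mul_le_of_le_one_left Λ.length_pos.le this⟩
  have hfinal := mul_boxMean_le hw1 hε0 hε2 hDk hσ0 hσ1.le hκσ (by positivity) H K Λ₀ t₁ t₂
    href₀.regular (by rw [href₀.dim_eq, hD]) (hscale.refinement hε0 (by linarith) href₀)
  have hgap : 3 / 4 * ω ≤ boxMean w Λ₀.carrier t₁ t₂ - ω / 16 - 3 * (2 * κ) * K := by
    linarith
  have h5 : K * (σ ^ 3 / 16) * (3 / 4 * ω) ≤ 2 :=
    (mul_le_mul_of_nonneg_left hgap (by positivity)).trans (hfinal.trans (by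
      nlinarith [sq_nonneg (shiftDensity E₁ Λ₀.carrier t₁),
        sq_nonneg (shiftDensity E₂ Λ₀.carrier t₂)]))
  have h6 : K * (σ ^ 3 / 16) * (3 / 4 * ω) = 3 / 64 * (K * (σ ^ 3 * ω)) := by ring
  linarith
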